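/- Let $l\ge 0$ and let $Q_l$ be the quiver with two nodes $1,2$, with $l$ arrows from node $2$ to node $1$ and no other arrows. Let $\zeta=(\zeta_1,\zeta_2)\in\mathbb{R}^2$ with $\zeta_1+\zeta_2=0$. A complex representation $S$ with dimension vector $d(S)$ is called stable if every subrepresentation $R\ne 0,S$ satisfies $$\frac{\sum_v\zeta_v d_v(R)}{\sum_v d_v(R)}<\frac{\sum_v\zeta_v d_v(S)}{\sum_v d_v(S)} .$$ Let $\mathcal{M}_l(\zeta)$ be the moduli space of stable representations with dimension vector $(1,1)$, i.e. the quotient of the set of stable points of $\mathrm{Hom}(\mathbb{C},\mathbb{C})^{l}$ by $GL_1(\mathbb{C})\times GL_1(\mathbb{C})$, with its quotient (classical) topology and its algebraic structure as a geometric quotient. Let $P(t)=\sum_i b_i t^i$ be its Poincaré polynomial, where $b_i$ is the dimension of the $i$-th rational singular homology of $\mathcal{M}_l(\zeta)$, and let $DT=(-1)^{\dim}\chi(\mathcal{M}_l(\zeta))$, where $\chi=\sum_i(-1)^ib_i$ and $\dim=l-1$ is the dimension of the space of representations minus that of the group modulo scalars. (1) If $\zeta_1<0$, then $\mathcal{M}_l(\zeta)$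 is isomorphic to $\mathbb{P}^{l-1}$ (by a homeomorphism for the classical topologies which identifies Zariski open sets and regular functions; $\mathbb{P}^{-1}=\emptyset$), its rational homology is finite-dimensional, and $$P(t)=\frac{t^{2l}-1}{t^2-1},\qquad DT=(-1)^{l-1}\,l .$$ (2) If $\zeta_1>0$, then $\mathcal{M}_l(\zeta)$ is empty, $P(t)=0$ and $DT=0$. (3) Example. Let $X\subset\mathbb{P}^1\times\mathbb{P}^3$ be a hypersurface of bidegree $(2,4)$, and for $t_1,t_2>0$ let $\mu(a,b)=\int_X (aJ_1+bJ_2)(t_1J_1+t_2J_2)^2$ be the slope of $\mathcal{O}_X(a,b)$, computed as the coefficient of $J_1J_2^3$ in $(aJ_1+bJ_2)(t_1J_1+t_2J_2)^2(2J_1+4J_2)$, where $J_1,J_2$ are the hyperplane classes. Take the quiver with $l=10$ arrows and $\zeta_1=c\,\mu(-1,1)$, $\zeta_2=c\,\mu(1,-1)$ with $c>0$. Then the invariant $DT$ of the quiver moduli space defined above is $-10$ if $t_2/t_1>4$ and $0$ if $0<t_2/t_1\le 4$. -/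

import Mathlib

open CategoryTheory AlgebraicTopology

/-! ### Representations of a quiver over `ℂ` and stability -/

/-- Representations of the quiver `V` with dimension vector `d`, in coordinates: the vector space at
the vertex `v` is `ℂ ^ d v`, and every arrow carries a matrix. -/
abbrev QuiverRep (V : Type) [Quiver.{0} V] (d : V → ℕ) : Type :=
  ∀ a : Quiver.Total V, Matrix (Fin (d a.right)) (Fin (d a.left)) ℂ

namespace QuiverRep

/-- The gauge group `∏ v, GL (d v)`. -/
abbrev Gauge (V : Type) (d : V → ℕ) : Type := ∀ v : V, GL (Fin (d v)) ℂ

variable {V : Type} [Quiver.{0} V] {d : V → ℕ}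

/-- The action by conjugation, `(g • f) a = g (head a) * f a * (g (tail a))⁻¹`. -/
instance gaugeAction : MulAction (Gauge V d) (QuiverRep V d) where
  smul g f := fun a => (g a.right).val * f a * ((g a.left)⁻¹).val
  one_smul f := by
    funext a
    change ((1 : GL (Fin (d a.right)) ℂ)).val * f a * ((1 : GL (Fin (d a.left)) ℂ)⁻¹).val = f a
    simp
  mul_smul g h f := by
    funext a
    change ((g a.right) * (h a.right)).val * f a * (((g a.left) * (h a.left))⁻¹).val =
      (g a.right).val * ((h a.right).val * f a * ((h a.left)⁻¹).val) * ((g a.left)⁻¹).val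
    rw [mul_inv_rev, Units.val_mul, Units.val_mul]
    simp only [Matrix.mul_assoc]

/-- A family of subspaces is a subrepresentation if every arrow maps the subspace at its tail into
the subspace at its head. -/
def IsSubrep (f : QuiverRep V d) (W : ∀ v, Submodule ℂ (Fin (d v) → ℂ)) : Prop :=
  ∀ a : Quiver.Total V, (W a.left).map (f a).mulVecLin ≤ W a.right

/-- The slope of a dimension vector with respect to the (Fayet–Iliopoulos) parameters `ζ`. -/
noncomputable def slope [Fintype V] (ζ : V → ℝ) (e : V → ℕ) : ℝ :=
  (∑ v, ζ v * (e v : ℝ)) / ∑ v, (e v : ℝ)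

/-- `f` is stable if every subrepresentation other than `0` and the whole has smaller slope. -/
def IsStable [Fintype V] (ζ : V → ℝ) (f : QuiverRep V d) : Prop :=
  ∀ W : ∀ v, Submodule ℂ (Fin (d v) → ℂ), f.IsSubrep W →
    (∃ v, W v ≠ ⊥) → (∃ v, W v ≠ ⊤) →
      slope ζ (fun v => Module.finrank ℂ (W v)) < slope ζ d

/-- The stable locus, with the topology inherited from the vector space of representations. -/
abbrev Stable [Fintype V] (d : V → ℕ) (ζ : V → ℝ) : Type :=
  {f : QuiverRep V d // f.IsStable ζ}

/-- Two stable representations are identified when they lie in the same gauge orbit. -/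
def stableSetoid [Fintype V] (d : V → ℕ) (ζ : V → ℝ) : Setoid (Stable d ζ) :=
  (MulAction.orbitRel (Gauge V d) (QuiverRep V d)).comap Subtype.val

/-- The moduli space of stable representations: the stable locus modulo the gauge group, with the
quotient of the classical (Euclidean) topology. -/
def Moduli [Fintype V] (d : V → ℕ) (ζ : V → ℝ) : Type :=
  Quotient (stableSetoid d ζ)

instance [Fintype V] (d : V → ℕ) (ζ : V → ℝ) : TopologicalSpace (Moduli d ζ) :=
  inferInstanceAs (TopologicalSpace (Quotient (stableSetoid d ζ)))

/-- The point of the moduli space given by a stable representation. -/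
def Moduli.mk [Fintype V] {ζ : V → ℝ} (f : Stable d ζ) : Moduli d ζ :=
  Quotient.mk (stableSetoid d ζ) f

/-- The index set of the matrix entries: the coordinates on the space of representations. -/
abbrev CoordIndex (V : Type) [Quiver.{0} V] (d : V → ℕ) : Type :=
  Σ a : Quiver.Total V, Fin (d a.right) × Fin (d a.left)

/-- The matrix entries of a representation. -/
def coords (f : QuiverRep V d) : CoordIndex V d → ℂ := fun i => f i.1 i.2.1 i.2.2

/-- `U` is a Zariski open subset of the moduli space and `φ` is a regular function on `U`, for the
algebraic structure of the geometric quotient: the pullback of `φ` to the stable locus is,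
locally for the Zariski topology, a quotient of two polynomials in the matrix entries.
(The values of `φ` outside `U` play no role.) -/
def Moduli.IsRegularOn [Fintype V] {ζ : V → ℝ} (U : Set (Moduli d ζ)) (φ : Moduli d ζ → ℂ) :
    Prop :=
  ∀ f : Stable d ζ, Moduli.mk f ∈ U →
    ∃ p q : MvPolynomial (CoordIndex V d) ℂ, MvPolynomial.eval (coords f.1) q ≠ 0 ∧
      ∀ f' : Stable d ζ, MvPolynomial.eval (coords f'.1) q ≠ 0 →
        Moduli.mk f' ∈ U ∧
          φ (Moduli.mk f') =
            MvPolynomial.eval (coords f'.1) p / MvPolynomial.eval (coords f'.1) q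

/-- The complex dimension of the moduli space (when it is non-empty): the dimension of the space of
representations minus the dimension of the gauge group modulo the scalars, which act trivially. -/
def moduliDim [Fintype V] [∀ v w : V, Fintype (v ⟶ w)] (d : V → ℕ) : ℤ :=
  (∑ v : V, ∑ w : V, (Fintype.card (v ⟶ w) : ℤ) * (d v : ℤ) * (d w : ℤ)) -
    ((∑ v : V, (d v : ℤ) ^ 2) - 1)

end QuiverRep

/-! ### Projective space -/

/-- The classical topology of the complex projective space: the quotient topology. -/
instance projectivizationTopology (n : ℕ) : TopologicalSpace (Projectivization ℂ (Fin n → ℂ)) :=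
  inferInstanceAs (TopologicalSpace (Quotient (projectivizationSetoid ℂ (Fin n → ℂ))))

/-- `U` is a Zariski open subset of projective space and `φ` is a regular function on `U`: locally
for the Zariski topology, `φ` is a quotient of homogeneous polynomials of the same degree. -/
def Projectivization.IsRegularOn {n : ℕ} (U : Set (Projectivization ℂ (Fin n → ℂ)))
    (φ : Projectivization ℂ (Fin n → ℂ) → ℂ) : Prop :=
  ∀ x ∈ U, ∃ (k : ℕ) (p q : MvPolynomial (Fin n) ℂ), p.IsHomogeneous k ∧ q.IsHomogeneous k ∧
    MvPolynomial.eval x.rep q ≠ 0 ∧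
      ∀ (v : Fin n → ℂ) (hv : v ≠ 0), MvPolynomial.eval v q ≠ 0 →
        Projectivization.mk ℂ v hv ∈ U ∧
          φ (Projectivization.mk ℂ v hv) = MvPolynomial.eval v p / MvPolynomial.eval v q

/-! ### Betti numbers and the Poincaré polynomial -/

/-- Singular homology with rational coefficients. -/
noncomputable abbrev rationalHomology (X : Type) [TopologicalSpace X] (i : ℕ) : ModuleCat.{0} ℚ :=
  ((singularHomologyFunctor (ModuleCat.{0} ℚ) i).obj (ModuleCat.of ℚ ℚ)).obj (TopCat.of X)

/-- The `i`-th Betti number. -/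
noncomputable def bettiNumber (X : Type) [TopologicalSpace X] (i : ℕ) : ℕ :=
  Module.finrank ℚ (rationalHomology X i)

/-- `X` has finite-dimensional rational homology, and `P = ∑ i, b i * t ^ i`. -/
def HasPoincarePolynomial (X : Type) [TopologicalSpace X] (P : Polynomial ℤ) : Prop :=
  ∀ i : ℕ, Module.Finite ℚ (rationalHomology X i) ∧ P.coeff i = (bettiNumber X i : ℤ)

/-- The Euler characteristic (of a space with finite-dimensional total rational homology). -/
noncomputable def eulerCharacteristic (X : Type) [TopologicalSpace X] : ℤ :=
  ∑ᶠ i : ℕ, (-1) ^ i * (bettiNumber X i : ℤ)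

/-- The Donaldson–Thomas invariant computed by the (smooth) moduli space of stable representations:
its Euler characteristic with the sign `(-1) ^ dim`. -/
noncomputable def QuiverRep.dtInvariant {V : Type} [Quiver.{0} V] [Fintype V]
    [∀ v w : V, Fintype (v ⟶ w)] (d : V → ℕ) (ζ : V → ℝ) : ℤ :=
  ((QuiverRep.moduliDim d).negOnePow : ℤ) * eulerCharacteristic (QuiverRep.Moduli d ζ)

/-! ### The loop-less quiver with two nodes -/

/-- The nodes of the quiver with `l` arrows from node 2 to node 1 and no other arrows. -/
inductive TwoNode (l : ℕ) : Type
  | n1 : TwoNode l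
  | n2 : TwoNode l

namespace TwoNode

instance (l : ℕ) : DecidableEq (TwoNode l)
  | n1, n1 => isTrue rfl
  | n2, n2 => isTrue rfl
  | n1, n2 => isFalse (by intro h; cases h)
  | n2, n1 => isFalse (by intro h; cases h)

instance (l : ℕ) : Fintype (TwoNode l) where
  elems := {n1, n2}
  complete v := by cases v <;> simp

/-- The arrows. -/
def Arrow (l : ℕ) : TwoNode l → TwoNode l → Type
  | n2, n1 => Fin l
  | n1, n1 => Empty
  | n1, n2 => Empty
  | n2, n2 => Empty

instance (l : ℕ) : Quiver.{0} (TwoNode l) where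
  Hom := Arrow l

instance (l : ℕ) : ∀ v w : TwoNode l, Fintype (v ⟶ w)
  | n2, n1 => inferInstanceAs (Fintype (Fin l))
  | n1, n1 => inferInstanceAs (Fintype Empty)
  | n1, n2 => inferInstanceAs (Fintype Empty)
  | n2, n2 => inferInstanceAs (Fintype Empty)

/-- The dimension vector `(1, 1)`. -/
abbrev dim (l : ℕ) : TwoNode l → ℕ := fun _ => 1

/-- The moduli space of stable representations with dimension vector `(1, 1)`. -/
abbrev Moduli (l : ℕ) (ζ : TwoNode l → ℝ) : Type := QuiverRep.Moduli (dim l) ζ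

end TwoNode

/-! ### Slopes of line bundles on the `(2, 4)` hypersurface in `ℙ¹ × ℙ³` -/

/-- The divisor class `a * J₁ + b * J₂` on `ℙ¹ × ℙ³`. -/
noncomputable def divisorClass (a b : ℝ) : MvPolynomial (Fin 2) ℝ :=
  MvPolynomial.C a * MvPolynomial.X 0 + MvPolynomial.C b * MvPolynomial.X 1

/-- The integral of `D` over a hypersurface of bidegree `(2, 4)` in `ℙ¹ × ℙ³`: the coefficient of the
point class `J₁ * J₂ ^ 3` in `D * (2 * J₁ + 4 * J₂)`. -/
noncomputable def integralOverX24 (D : MvPolynomial (Fin 2) ℝ) : ℝ :=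
  (D * divisorClass 2 4).coeff (Finsupp.single 0 1 + Finsupp.single 1 3)

/-- The slope of the line bundle `𝒪_X(a, b)` on the `(2, 4)` hypersurface `X`, with respect to the
Kähler class `t₁ * J₁ + t₂ * J₂`. -/
noncomputable def slopeX24 (a b : ℤ) (t₁ t₂ : ℝ) : ℝ :=
  integralOverX24 (divisorClass a b * divisorClass t₁ t₂ ^ 2)

/-- The parameters of the quiver of the splitting `𝒪_X(-1, 1) ⊕ 𝒪_X(1, -1)`, which has ten arrows:
the slopes of the two line bundles, up to a proportionality constant `c`. -/
noncomputable def zetaX24 (c t₁ t₂ : ℝ) : TwoNode 10 → ℝ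
  | .n1 => c * slopeX24 (-1) 1 t₁ t₂
  | .n2 => c * slopeX24 1 (-1) t₁ t₂

/-!
A representation with dimension vector `(1, 1)` is a vector `v` of `ℂ ^ l`, on which the gauge group
acts by scalars. The subspace at node 1 is always a subrepresentation, so stability forces
`ζ₁ < 0`; the only other candidate is the subspace at node 2, which is a subrepresentation exactly
when `v = 0`. Hence there are no stable points if `ζ₁ ≥ 0`, and if `ζ₁ < 0` the stable locus is
`ℂ ^ l ∖ {0}` (`TwoNode.isStable_iff`) and the moduli space is the projective space
(`TwoNode.moduliHomeomorph`). Regular functions on the two sides agree (`TwoNode.isRegularOn_iff`):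
a quotient of polynomials which is constant along the lines through the origin equals the quotient
of the homogeneous components of any degree in which the denominator does not vanish.

What remains is the rational singular homology of `ℙ ^ (l - 1)`, which rests on the Mayer–Vietoris
sequence of an open cover (`hasMayerVietoris_of_isOpen`). Its geometric input is that chains may be
replaced by chains that are small with respect to the cover: iterated barycentric subdivision makes
affine simplices arbitrarily small, and it is naturally homotopic to the identity. Subdivision and
homotopy are built on formal chains of ordered tuples of points by induction, as cones over the
barycentre, and are transported to singular chains by naturality. The long exact sequence then comes
from the short exact sequence formed by the chains on the intersection, the chains on the two
pieces, and the small chains.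

For the Betti numbers only dimensions in these sequences are counted (`HasBetti.exists_of_union`).
A punctured real vector space is treated by induction on the dimension (`hasBetti_punctured`).
Projective space is the union of an affine chart, which is contractible, and the complement of the
origin of that chart, which retracts onto the hyperplane at infinity; the intersection is a
punctured vector space. Induction gives Betti number one in the even degrees below `2 * l`
(`Projectivization.hasBetti`).

For the hypersurface of bidegree `(2, 4)`, expanding the intersection number gives
`ζ₁ = c * (2 * t₂ * (4 * t₁ - t₂))` and `ζ₂ = -ζ₁`, so the wall is at `t₂ / t₁ = 4`.
-/

/-! ### Subdivision of chains of ordered tuples -/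

namespace TupleChain

variable {P Q : Type*} {k : ℕ}

/-- Rational chains of ordered `k`-tuples of points of `P`. A `k`-tuple plays the role of the
vertices of an affine simplex of dimension `k - 1`; the empty tuple provides the augmentation. -/
abbrev Chain (P : Type*) (k : ℕ) : Type _ := (Fin k → P) →₀ ℚ

/-- The alternating sum of the faces. -/
noncomputable def boundary (P : Type*) (k : ℕ) : Chain P (k + 1) →ₗ[ℚ] Chain P k :=
  ∑ i : Fin (k + 1), (-1 : ℚ) ^ (i : ℕ) •
    Finsupp.lmapDomain ℚ ℚ (fun v : Fin (k + 1) → P => v ∘ i.succAbove)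

/-- The cone with apex `b`: the apex is added as first vertex. -/
noncomputable def cone (b : P) : Chain P k →ₗ[ℚ] Chain P (k + 1) :=
  Finsupp.lmapDomain ℚ ℚ (fun v : Fin k → P => (Fin.cons b v : Fin (k + 1) → P))

/-- The map induced on chains by a map of points. -/
noncomputable def map (f : P → Q) (k : ℕ) : Chain P k →ₗ[ℚ] Chain Q k :=
  Finsupp.lmapDomain ℚ ℚ (fun v : Fin k → P => f ∘ v)

lemma boundary_single (v : Fin (k + 1) → P) :
    boundary P k (Finsupp.single v 1) =
      ∑ i : Fin (k + 1), (-1 : ℚ) ^ (i : ℕ) • Finsupp.single (v ∘ i.succAbove) 1 := by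
  simp [boundary, Finsupp.mapDomain_single]

@[simp] lemma cone_single (b : P) (v : Fin k → P) (r : ℚ) :
    cone b (Finsupp.single v r) = Finsupp.single (Fin.cons b v : Fin (k + 1) → P) r := by
  simp [cone, Finsupp.mapDomain_single]

@[simp] lemma map_single (f : P → Q) (v : Fin k → P) (r : ℚ) :
    map f k (Finsupp.single v r) = Finsupp.single (f ∘ v) r := by
  simp [map, Finsupp.mapDomain_single]

lemma cons_comp_succ_succAbove (b : P) (v : Fin (k + 1) → P) (i : Fin (k + 1)) :
    (Fin.cons b v : Fin (k + 2) → P) ∘ i.succ.succAbove =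
      (Fin.cons b (v ∘ i.succAbove) : Fin (k + 1) → P) := by
  funext j
  refine Fin.cases ?_ (fun j => ?_) j <;> simp

lemma boundary_cone (b : P) (c : Chain P (k + 1)) :
    boundary P (k + 1) (cone b c) = c - cone b (boundary P k c) := by
  suffices h : (boundary P (k + 1)).comp (cone b) =
      LinearMap.id - (cone b).comp (boundary P k) from LinearMap.congr_fun h c
  ext v : 1
  ext1
  simp only [LinearMap.comp_apply, Finsupp.lsingle_apply, LinearMap.sub_apply,
    LinearMap.id_apply, cone_single, boundary_single, map_sum, map_smul]
  rw [Fin.sum_univ_succ]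
  simp only [cons_comp_succ_succAbove, Fin.val_succ, pow_succ]
  have : (Fin.cons b v : Fin (k + 2) → P) ∘ (0 : Fin (k + 2)).succAbove = v := by
    funext j; simp
  rw [this]
  simp [Finset.sum_neg_distrib, sub_eq_add_neg]

lemma boundary_cone_zero (b : P) (c : Chain P 0) : boundary P 0 (cone b c) = c := by
  suffices h : (boundary P 0).comp (cone b) = LinearMap.id from LinearMap.congr_fun h c
  ext v : 1
  ext1
  simp only [LinearMap.comp_apply, Finsupp.lsingle_apply, LinearMap.id_apply, cone_single,
    boundary_single]
  simp [Subsingleton.elim _ v]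

lemma boundary_boundary (c : Chain P (k + 2)) : boundary P k (boundary P (k + 1) c) = 0 := by
  -- Every non-empty tuple is a cone over its tail, so the cone formula gives an induction.
  have key (k : ℕ) (h : ∀ (b : P) (w : Fin (k + 1) → P),
      boundary P k (boundary P (k + 1) (cone b (Finsupp.single w 1))) = 0) (c : Chain P (k + 2)) :
      boundary P k (boundary P (k + 1) c) = 0 := by
    suffices h : (boundary P k).comp (boundary P (k + 1)) = 0 from LinearMap.congr_fun h c
    ext v : 1
    ext1
    simpa [Fin.cons_self_tail] using h (v 0) (Fin.tail v)
  induction k with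
  | zero =>
    refine key 0 (fun b w => ?_) c
    rw [boundary_cone, map_sub, boundary_cone_zero, sub_self]
  | succ k ih =>
    refine key (k + 1) (fun b w => ?_) c
    rw [boundary_cone, map_sub, boundary_cone, ih, map_zero, sub_zero, sub_self]

lemma map_boundary (f : P → Q) (c : Chain P (k + 1)) :
    map f k (boundary P k c) = boundary Q k (map f (k + 1) c) := by
  suffices h : (map f k).comp (boundary P k) = (boundary Q k).comp (map f (k + 1)) from
    LinearMap.congr_fun h c
  ext v : 1
  ext1
  simp only [LinearMap.comp_apply, Finsupp.lsingle_apply, boundary_single, map_single, map_sum,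
    map_smul]
  rfl

lemma map_cone (f : P → Q) (b : P) (c : Chain P k) :
    map f (k + 1) (cone b c) = cone (f b) (map f k c) := by
  suffices h : (map f (k + 1)).comp (cone b) = (cone (f b)).comp (map f k) from
    LinearMap.congr_fun h c
  ext v : 1
  ext1
  simp only [LinearMap.comp_apply, Finsupp.lsingle_apply, map_single, cone_single]
  congr 1
  funext j
  refine Fin.cases ?_ (fun j => ?_) j <;> simp

variable (β : ∀ k : ℕ, (Fin (k + 1) → P) → P)

/-- The subdivision with centres `β`: the simplex `v` is replaced by the cone with apex `β v` over
the subdivision of its boundary. -/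
noncomputable def subdiv : ∀ k : ℕ, Chain P k →ₗ[ℚ] Chain P k
  | 0 => LinearMap.id
  | k + 1 => Finsupp.linearCombination ℚ fun v =>
      cone (β k v) (subdiv k (boundary P k (Finsupp.single v 1)))

/-- The natural homotopy between the identity and the subdivision. -/
noncomputable def subdivHomotopy : ∀ k : ℕ, Chain P k →ₗ[ℚ] Chain P (k + 1)
  | 0 => 0
  | k + 1 => Finsupp.linearCombination ℚ fun v =>
      cone (β k v) (Finsupp.single v 1 - subdivHomotopy k (boundary P k (Finsupp.single v 1)))

lemma subdiv_single (v : Fin (k + 1) → P) :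
    subdiv β (k + 1) (Finsupp.single v 1) =
      cone (β k v) (subdiv β k (boundary P k (Finsupp.single v 1))) := by
  simp [subdiv]

lemma subdivHomotopy_single (v : Fin (k + 1) → P) :
    subdivHomotopy β (k + 1) (Finsupp.single v 1) =
      cone (β k v) (Finsupp.single v 1 -
        subdivHomotopy β k (boundary P k (Finsupp.single v 1))) := by
  simp [subdivHomotopy]

lemma boundary_subdiv (c : Chain P (k + 1)) :
    boundary P k (subdiv β (k + 1) c) = subdiv β k (boundary P k c) := by
  have key (k : ℕ) (h : ∀ v : Fin (k + 1) → P,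
      boundary P k (cone (β k v) (subdiv β k (boundary P k (Finsupp.single v 1)))) =
        subdiv β k (boundary P k (Finsupp.single v 1))) (c : Chain P (k + 1)) :
      boundary P k (subdiv β (k + 1) c) = subdiv β k (boundary P k c) := by
    suffices h : (boundary P k).comp (subdiv β (k + 1)) = (subdiv β k).comp (boundary P k) from
      LinearMap.congr_fun h c
    ext v : 1
    ext1
    simpa [subdiv_single] using h v
  induction k with
  | zero => exact key 0 (fun v => boundary_cone_zero _ _) c
  | succ k ih =>
    refine key (k + 1) (fun v => ?_) c
    rw [boundary_cone, ih, boundary_boundary, map_zero, map_zero, sub_zero]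

lemma boundary_subdivHomotopy (c : Chain P (k + 1)) :
    boundary P (k + 1) (subdivHomotopy β (k + 1) c) +
      subdivHomotopy β k (boundary P k c) = c - subdiv β (k + 1) c := by
  have key (k : ℕ) (h : ∀ v : Fin (k + 1) → P,
      boundary P k (subdivHomotopy β k (boundary P k (Finsupp.single v 1))) =
        boundary P k (Finsupp.single v 1) - subdiv β k (boundary P k (Finsupp.single v 1)))
      (c : Chain P (k + 1)) :
      boundary P (k + 1) (subdivHomotopy β (k + 1) c) +
        subdivHomotopy β k (boundary P k c) = c - subdiv β (k + 1) c := by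
    suffices h : (boundary P (k + 1)).comp (subdivHomotopy β (k + 1)) +
        (subdivHomotopy β k).comp (boundary P k) = LinearMap.id - subdiv β (k + 1) from
      LinearMap.congr_fun h c
    ext v : 1
    ext1
    simp only [LinearMap.comp_apply, Finsupp.lsingle_apply, LinearMap.add_apply,
      LinearMap.sub_apply, LinearMap.id_apply, subdiv_single, subdivHomotopy_single]
    rw [boundary_cone, map_sub (boundary P k), h, sub_sub_cancel]
    abel
  induction k with
  | zero => exact key 0 (fun v => by simp [subdivHomotopy, subdiv]) c
  | succ k ih =>
    refine key (k + 1) (fun v => ?_) c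
    have h := ih (boundary P (k + 1) (Finsupp.single v 1))
    rwa [boundary_boundary, map_zero, add_zero] at h

variable {β} {γ : ∀ k : ℕ, (Fin (k + 1) → Q) → Q} {f : P → Q}

lemma map_subdiv (hf : ∀ k v, f (β k v) = γ k (f ∘ v)) (c : Chain P k) :
    map f k (subdiv β k c) = subdiv γ k (map f k c) := by
  induction k with
  | zero => rfl
  | succ k ih =>
    suffices h : (map f (k + 1)).comp (subdiv β (k + 1)) =
        (subdiv γ (k + 1)).comp (map f (k + 1)) from LinearMap.congr_fun h c
    ext v : 1
    ext1
    simp only [LinearMap.comp_apply, Finsupp.lsingle_apply, subdiv_single, map_single, map_cone,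
      ih, map_boundary, hf]

lemma map_subdivHomotopy (hf : ∀ k v, f (β k v) = γ k (f ∘ v)) (c : Chain P k) :
    map f (k + 1) (subdivHomotopy β k c) = subdivHomotopy γ k (map f k c) := by
  induction k with
  | zero => simp [subdivHomotopy]
  | succ k ih =>
    suffices h : (map f (k + 2)).comp (subdivHomotopy β (k + 1)) =
        (subdivHomotopy γ (k + 1)).comp (map f (k + 1)) from LinearMap.congr_fun h c
    ext v : 1
    ext1
    simp only [LinearMap.comp_apply, Finsupp.lsingle_apply, subdivHomotopy_single, map_single,
      map_cone, map_sub, ih, map_boundary, hf]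

end TupleChain

/-! ### Affine simplices in a standard simplex -/

namespace AffineSimplex

open TupleChain

variable {k l m : ℕ}

/-- The affine map from a standard simplex to another one with prescribed images of the vertices. -/
noncomputable def affine (w : Fin k → stdSimplex ℝ (Fin l)) :
    C(stdSimplex ℝ (Fin k), stdSimplex ℝ (Fin l)) where
  toFun x := ⟨∑ i, x i • (w i : Fin l → ℝ),
    (convex_stdSimplex ℝ (Fin l)).sum_mem (fun i _ => x.2.1 i) x.2.2 fun i _ => (w i).2⟩
  continuous_toFun := by
    refine Continuous.subtype_mk (continuous_finsetSum _ fun i _ => ?_) _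
    exact ((continuous_apply i).comp continuous_subtype_val).smul continuous_const

lemma affine_val (w : Fin k → stdSimplex ℝ (Fin l)) (x : stdSimplex ℝ (Fin k)) :
    (affine w x).1 = ∑ i, x.1 i • (w i).1 := rfl

lemma affine_affine (v : Fin l → stdSimplex ℝ (Fin m)) (w : Fin k → stdSimplex ℝ (Fin l)) :
    (affine v).comp (affine w) = affine (affine v ∘ w) := by
  ext x : 1
  apply Subtype.ext
  simp only [ContinuousMap.comp_apply, affine_val, Function.comp_apply, Finset.smul_sum,
    Finset.sum_apply, Pi.smul_apply, Finset.sum_smul, smul_eq_mul, mul_smul]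
  rw [Finset.sum_comm]

lemma affine_vertex : affine (fun i : Fin k => stdSimplex.vertex (S := ℝ) i) =
    ContinuousMap.id _ := by
  ext x : 1
  apply Subtype.ext
  funext j
  simp [affine_val, Finset.sum_apply, Pi.single_apply]

lemma affine_comp (v : Fin l → stdSimplex ℝ (Fin m)) (f : Fin k → Fin l) :
    affine (v ∘ f) = (affine v).comp ⟨stdSimplex.map f, stdSimplex.continuous_map f⟩ := by
  ext x : 1
  apply Subtype.ext
  simp only [ContinuousMap.comp_apply, affine_val, ContinuousMap.coe_mk, Function.comp_apply]
  rw [← Finset.sum_fiberwise Finset.univ f]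
  refine Finset.sum_congr rfl fun j _ => ?_
  have : (stdSimplex.map f x).1 j = ∑ i with f i = j, x.1 i := by
    change (FunOnFinite.linearMap ℝ ℝ f x.1) j = _
    rw [FunOnFinite.linearMap_apply_apply]
  rw [this, Finset.sum_smul]
  refine Finset.sum_congr rfl fun i hi => ?_
  rw [(Finset.mem_filter.1 hi).2]

/-- The barycentre of a tuple of points. -/
noncomputable def center (l k : ℕ) (v : Fin (k + 1) → stdSimplex ℝ (Fin l)) :
    stdSimplex ℝ (Fin l) :=
  affine v stdSimplex.barycenter

lemma affine_center (v : Fin l → stdSimplex ℝ (Fin m)) (k : ℕ)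
    (w : Fin (k + 1) → stdSimplex ℝ (Fin l)) :
    affine v (center l k w) = center m k (affine v ∘ w) := by
  rw [center, center, ← affine_affine]
  rfl

lemma affine_mem_closedBall {w : Fin k → stdSimplex ℝ (Fin l)} {p : stdSimplex ℝ (Fin l)} {r : ℝ}
    (h : ∀ i, dist (w i) p ≤ r) (x : stdSimplex ℝ (Fin k)) : dist (affine w x) p ≤ r := by
  have := (convex_closedBall p.1 r).sum_mem (t := Finset.univ) (w := x.1)
    (z := fun i => (w i).1) (fun i _ => x.2.1 i) x.2.2 fun i _ => h i
  exact this

lemma dist_center_le {v : Fin (k + 1) → stdSimplex ℝ (Fin l)} {D : ℝ}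
    (h : ∀ i j, dist (v i) (v j) ≤ D) (j : Fin (k + 1)) :
    dist (v j) (center l k v) ≤ k / (k + 1) * D := by
  rw [dist_comm, Subtype.dist_eq, dist_eq_norm]
  have e : (center l k v).1 - (v j).1 = ∑ i, ((k : ℝ) + 1)⁻¹ • ((v i).1 - (v j).1) := by
    simp only [center, affine_val, smul_sub, Finset.sum_sub_distrib, stdSimplex.barycenter_apply,
      Fintype.card_fin, Finset.sum_const, Finset.card_univ, Nat.cast_add, Nat.cast_one]
    congr 1
    rw [← Nat.cast_smul_eq_nsmul ℝ, smul_smul, Nat.cast_add, Nat.cast_one,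
      mul_inv_cancel₀ (by positivity), one_smul]
  rw [e]
  refine (norm_sum_le _ _).trans ?_
  rw [← Finset.sum_erase Finset.univ (a := j) (by simp)]
  refine (Finset.sum_le_card_nsmul _ _ (((k : ℝ) + 1)⁻¹ * D) fun i _ => ?_).trans (le_of_eq ?_)
  · rw [norm_smul, norm_inv, Real.norm_of_nonneg (by positivity)]
    have := h i j
    rw [Subtype.dist_eq, dist_eq_norm] at this
    gcongr
  · rw [Finset.card_erase_of_mem (Finset.mem_univ j), Finset.card_univ, Fintype.card_fin,
      nsmul_eq_mul, Nat.add_sub_cancel]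
    ring

/-- The tuples with distances at most `D` between their entries. -/
def meshLE (l k : ℕ) (D : ℝ) : Set (Fin k → stdSimplex ℝ (Fin l)) :=
  {w | ∀ i j, dist (w i) (w j) ≤ D}

/-- Barycentric subdivision contracts the mesh of an affine `(k - 1)`-simplex by `(k - 1) / k`, and
produces simplices inside the given one. -/
lemma subdiv_single_mem (v : Fin k → stdSimplex ℝ (Fin l)) {D : ℝ} (hv : v ∈ meshLE l k D) :
    subdiv (center l) k (Finsupp.single v 1) ∈ Finsupp.supported ℚ ℚ
      (meshLE l k (((k : ℝ) - 1) / k * D) ∩ {w | ∀ i, w i ∈ Set.range (affine v)}) := by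
  induction k with
  | zero => exact Finsupp.single_mem_supported ℚ 1 ⟨fun i => i.elim0, fun i => i.elim0⟩
  | succ k ih =>
    have hD : 0 ≤ D := dist_nonneg.trans (hv 0 0)
    rw [subdiv_single, boundary_single, map_sum, map_sum]
    refine Submodule.sum_mem _ fun i _ => ?_
    rw [map_smul, map_smul]
    refine Submodule.smul_mem _ _ ?_
    refine Finsupp.supported_comap_lmapDomain ℚ ℚ _ _
      (Finsupp.supported_mono ?_ (ih (v ∘ i.succAbove) fun a b => hv _ _))
    rintro w ⟨hw, hwv⟩
    have hsub (a : Fin k) : w a ∈ Set.range (affine v) := by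
      obtain ⟨x, hx⟩ := hwv a
      rw [affine_comp] at hx
      exact ⟨_, hx⟩
    have hc : ((k + 1 : ℕ) : ℝ) - 1 = k := by push_cast; ring
    have hcen (a : Fin k) : dist (w a) (center l k v) ≤ k / (k + 1) * D := by
      obtain ⟨x, hx⟩ := hsub a
      rw [← hx]
      exact affine_mem_closedBall (dist_center_le hv) x
    refine ⟨fun a b => ?_, fun a => ?_⟩
    · rw [hc, Nat.cast_add, Nat.cast_one]
      refine Fin.cases ?_ (fun a => ?_) a <;> refine Fin.cases ?_ (fun b => ?_) b <;>
        simp only [Fin.cons_zero, Fin.cons_succ]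
      · rw [dist_self]; positivity
      · rw [dist_comm]; exact hcen b
      · exact hcen a
      · refine (hw a b).trans ?_
        have hk : (0 : ℝ) < k := by exact_mod_cast a.pos
        refine mul_le_mul_of_nonneg_right ?_ hD
        rw [div_le_div_iff₀ hk (by positivity)]
        nlinarith
    · refine Fin.cases ⟨_, rfl⟩ (fun a => ?_) a
      simpa using hsub a

lemma subdiv_mem_meshLE {D : ℝ} {c : Chain (stdSimplex ℝ (Fin l)) k}
    (hc : c ∈ Finsupp.supported ℚ ℚ (meshLE l k D)) :
    subdiv (center l) k c ∈ Finsupp.supported ℚ ℚ (meshLE l k (((k : ℝ) - 1) / k * D)) := by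
  rw [Finsupp.supported_eq_span_single] at hc
  refine Submodule.span_le (p := (Finsupp.supported ℚ ℚ _).comap (subdiv (center l) k)).2 ?_ hc
  rintro _ ⟨v, hv, rfl⟩
  exact Finsupp.supported_mono Set.inter_subset_left (subdiv_single_mem v hv)

lemma iterate_subdiv_mem_meshLE {D : ℝ} {c : Chain (stdSimplex ℝ (Fin l)) k}
    (hc : c ∈ Finsupp.supported ℚ ℚ (meshLE l k D)) (N : ℕ) :
    (subdiv (center l) k)^[N] c ∈
      Finsupp.supported ℚ ℚ (meshLE l k ((((k : ℝ) - 1) / k) ^ N * D)) := by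
  induction N with
  | zero => simpa using hc
  | succ N ih =>
    rw [Function.iterate_succ_apply', pow_succ', mul_assoc]
    exact subdiv_mem_meshLE ih

end AffineSimplex

/-! ### Subdivision of singular chains -/

namespace SingularChain

open TupleChain AffineSimplex

variable {X : Type} [TopologicalSpace X] {n m : ℕ}

/-- Rational singular chains. -/
abbrev Chain (X : Type) [TopologicalSpace X] (n : ℕ) : Type :=
  C(stdSimplex ℝ (Fin (n + 1)), X) →₀ ℚ

/-- The `i`-th face of a singular simplex. -/
noncomputable def face (i : Fin (n + 2)) (σ : C(stdSimplex ℝ (Fin (n + 2)), X)) :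
    C(stdSimplex ℝ (Fin (n + 1)), X) :=
  σ.comp ⟨stdSimplex.map i.succAbove, stdSimplex.continuous_map _⟩

/-- The boundary of singular chains. -/
noncomputable def boundary (X : Type) [TopologicalSpace X] (n : ℕ) :
    Chain X (n + 1) →ₗ[ℚ] Chain X n :=
  ∑ i : Fin (n + 2), (-1 : ℚ) ^ (i : ℕ) • Finsupp.lmapDomain ℚ ℚ (face i)

/-- The singular chain of affine simplices in the domain of `σ`, composed with `σ`. -/
noncomputable def push (σ : C(stdSimplex ℝ (Fin m), X)) (n : ℕ) :
    TupleChain.Chain (stdSimplex ℝ (Fin m)) (n + 1) →ₗ[ℚ] Chain X n :=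
  Finsupp.lmapDomain ℚ ℚ fun w => σ.comp (affine w)

/-- The tuple of the vertices of the standard simplex. -/
noncomputable abbrev vertices (k : ℕ) : TupleChain.Chain (stdSimplex ℝ (Fin k)) k :=
  Finsupp.single (fun i => stdSimplex.vertex i) 1

lemma push_single (σ : C(stdSimplex ℝ (Fin m), X)) (w : Fin (n + 1) → stdSimplex ℝ (Fin m))
    (r : ℚ) : push σ n (Finsupp.single w r) = Finsupp.single (σ.comp (affine w)) r := by
  simp [push, Finsupp.mapDomain_single]

lemma push_vertices (σ : C(stdSimplex ℝ (Fin (n + 1)), X)) :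
    push σ n (vertices (n + 1)) = Finsupp.single σ 1 := by
  rw [push_single, affine_vertex, ContinuousMap.comp_id]

lemma boundary_push (σ : C(stdSimplex ℝ (Fin m), X))
    (c : TupleChain.Chain (stdSimplex ℝ (Fin m)) (n + 2)) :
    boundary X n (push σ (n + 1) c) = push σ n (TupleChain.boundary _ _ c) := by
  suffices h : (boundary X n).comp (push σ (n + 1)) =
      (push σ n).comp (TupleChain.boundary _ _) from LinearMap.congr_fun h c
  ext v : 1
  ext1
  simp only [LinearMap.comp_apply, Finsupp.lsingle_apply, push_single,
    TupleChain.boundary_single, map_sum, map_smul, boundary, LinearMap.sum_apply,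
    LinearMap.smul_apply, Finsupp.lmapDomain_apply, Finsupp.mapDomain_single]
  refine Finset.sum_congr rfl fun i _ => ?_
  rw [affine_comp]
  rfl

lemma push_affine (σ : C(stdSimplex ℝ (Fin m), X)) {k : ℕ} (v : Fin k → stdSimplex ℝ (Fin m))
    (c : TupleChain.Chain (stdSimplex ℝ (Fin k)) (n + 1)) :
    push (σ.comp (affine v)) n c = push σ n (map (affine v) (n + 1) c) := by
  suffices h : push (σ.comp (affine v)) n = (push σ n).comp (map (affine v) (n + 1)) from
    LinearMap.congr_fun h c
  ext w : 1
  ext1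
  simp only [LinearMap.comp_apply, Finsupp.lsingle_apply, push_single, map_single]
  rw [ContinuousMap.comp_assoc, affine_affine]

/-- Barycentric subdivision of singular chains. -/
noncomputable def sd (X : Type) [TopologicalSpace X] (n : ℕ) : Chain X n →ₗ[ℚ] Chain X n :=
  Finsupp.linearCombination ℚ fun σ => push σ n (subdiv (center _) (n + 1) (vertices (n + 1)))

/-- The homotopy between the identity and barycentric subdivision. -/
noncomputable def sdHomotopy (X : Type) [TopologicalSpace X] (n : ℕ) :
    Chain X n →ₗ[ℚ] Chain X (n + 1) :=
  Finsupp.linearCombination ℚ fun σ =>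
    push σ (n + 1) (subdivHomotopy (center _) (n + 1) (vertices (n + 1)))

lemma map_affine_vertices {k : ℕ} (w : Fin k → stdSimplex ℝ (Fin m)) :
    map (affine w) k (vertices k) = Finsupp.single w 1 := by
  rw [map_single]
  congr 1
  funext i
  apply Subtype.ext
  simp [affine_val, Pi.single_apply]

lemma sd_push (σ : C(stdSimplex ℝ (Fin m), X))
    (c : TupleChain.Chain (stdSimplex ℝ (Fin m)) (n + 1)) :
    sd X n (push σ n c) = push σ n (subdiv (center m) (n + 1) c) := by
  suffices h : (sd X n).comp (push σ n) = (push σ n).comp (subdiv (center m) (n + 1)) from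
    LinearMap.congr_fun h c
  ext w : 1
  ext1
  simp only [LinearMap.comp_apply, Finsupp.lsingle_apply, push_single, sd,
    Finsupp.linearCombination_single, one_smul]
  rw [push_affine, map_subdiv (affine_center w), map_affine_vertices]

lemma sdHomotopy_push (σ : C(stdSimplex ℝ (Fin m), X))
    (c : TupleChain.Chain (stdSimplex ℝ (Fin m)) (n + 1)) :
    sdHomotopy X n (push σ n c) = push σ (n + 1) (subdivHomotopy (center m) (n + 1) c) := by
  suffices h : (sdHomotopy X n).comp (push σ n) =
      (push σ (n + 1)).comp (subdivHomotopy (center m) (n + 1)) from LinearMap.congr_fun h c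
  ext w : 1
  ext1
  simp only [LinearMap.comp_apply, Finsupp.lsingle_apply, push_single, sdHomotopy,
    Finsupp.linearCombination_single, one_smul]
  rw [push_affine, map_subdivHomotopy (affine_center w), map_affine_vertices]

lemma boundary_sd (c : Chain X (n + 1)) :
    boundary X n (sd X (n + 1) c) = sd X n (boundary X n c) := by
  suffices h : (boundary X n).comp (sd X (n + 1)) = (sd X n).comp (boundary X n) from
    LinearMap.congr_fun h c
  ext σ : 1
  ext1
  simp only [LinearMap.comp_apply, Finsupp.lsingle_apply]
  rw [← push_vertices, sd_push, boundary_push, boundary_push, sd_push, boundary_subdiv]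

lemma boundary_sdHomotopy (c : Chain X (n + 1)) :
    boundary X (n + 1) (sdHomotopy X (n + 1) c) + sdHomotopy X n (boundary X n c) =
      c - sd X (n + 1) c := by
  suffices h : (boundary X (n + 1)).comp (sdHomotopy X (n + 1)) +
      (sdHomotopy X n).comp (boundary X n) = LinearMap.id - sd X (n + 1) from
    LinearMap.congr_fun h c
  ext σ : 1
  ext1
  simp only [LinearMap.comp_apply, Finsupp.lsingle_apply, LinearMap.add_apply,
    LinearMap.sub_apply, LinearMap.id_apply]
  rw [← push_vertices, sdHomotopy_push, boundary_push, boundary_push, sdHomotopy_push, sd_push,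
    ← map_add, boundary_subdivHomotopy, map_sub]

/-! ### Small chains -/

variable (𝒰 : Set (Set X))

/-- The singular simplices with image in a member of `𝒰`. -/
def smallSimplices (n : ℕ) : Set C(stdSimplex ℝ (Fin (n + 1)), X) :=
  {σ | ∃ U ∈ 𝒰, Set.range σ ⊆ U}

/-- The chains of singular simplices with images in members of `𝒰`. -/
noncomputable def small (n : ℕ) : Submodule ℚ (Chain X n) :=
  Finsupp.supported ℚ ℚ (smallSimplices 𝒰 n)

variable {𝒰}

lemma push_mem_small {σ : C(stdSimplex ℝ (Fin (m + 1)), X)} (hσ : σ ∈ smallSimplices 𝒰 m)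
    (c : TupleChain.Chain (stdSimplex ℝ (Fin (m + 1))) (n + 1)) : push σ n c ∈ small 𝒰 n := by
  obtain ⟨U, hU, h⟩ := hσ
  refine Finsupp.supported_comap_lmapDomain ℚ ℚ _ _
    (Finsupp.supported_mono ?_ ((Finsupp.mem_supported ℚ c).2 (Set.subset_univ _)))
  intro w _
  exact ⟨U, hU, (Set.range_comp_subset_range (affine w) σ).trans h⟩

lemma linearCombination_mem_small {f : C(stdSimplex ℝ (Fin (m + 1)), X) → Chain X n}
    (hf : ∀ σ ∈ smallSimplices 𝒰 m, f σ ∈ small 𝒰 n) {c : Chain X m} (hc : c ∈ small 𝒰 m) :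
    Finsupp.linearCombination ℚ f c ∈ small 𝒰 n := by
  rw [Finsupp.linearCombination_apply]
  exact Submodule.sum_mem _ fun σ hσ => Submodule.smul_mem _ _
    (hf σ ((Finsupp.mem_supported ℚ c).1 hc hσ))

lemma sd_mem_small {c : Chain X n} (hc : c ∈ small 𝒰 n) : sd X n c ∈ small 𝒰 n :=
  linearCombination_mem_small (fun _ hσ => push_mem_small hσ _) hc

lemma sdHomotopy_mem_small {c : Chain X n} (hc : c ∈ small 𝒰 n) :
    sdHomotopy X n c ∈ small 𝒰 (n + 1) :=
  linearCombination_mem_small (fun _ hσ => push_mem_small hσ _) hc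

lemma iterate_sd_mem_small {c : Chain X n} (hc : c ∈ small 𝒰 n) (N : ℕ) :
    (sd X n)^[N] c ∈ small 𝒰 n := by
  induction N with
  | zero => exact hc
  | succ N ih => rw [Function.iterate_succ_apply']; exact sd_mem_small ih

lemma iterate_sd_push (σ : C(stdSimplex ℝ (Fin m), X))
    (c : TupleChain.Chain (stdSimplex ℝ (Fin m)) (n + 1)) (N : ℕ) :
    (sd X n)^[N] (push σ n c) = push σ n ((subdiv (center m) (n + 1))^[N] c) := by
  induction N with
  | zero => rfl
  | succ N ih => rw [Function.iterate_succ_apply', ih, sd_push, Function.iterate_succ_apply']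

/-- By Lebesgue's number lemma, iterated subdivision makes a singular simplex small. -/
lemma exists_iterate_sd_single_mem_small (ho : ∀ U ∈ 𝒰, IsOpen U) (hc : ⋃₀ 𝒰 = Set.univ)
    (σ : C(stdSimplex ℝ (Fin (n + 1)), X)) :
    ∃ N, (sd X n)^[N] (Finsupp.single σ 1) ∈ small 𝒰 n := by
  obtain ⟨δ, hδ, hleb⟩ := lebesgue_number_lemma_of_metric
    (s := (Set.univ : Set (stdSimplex ℝ (Fin (n + 1))))) (c := fun U : 𝒰 => σ ⁻¹' U.1)
    isCompact_univ (fun U => (ho U.1 U.2).preimage σ.continuous) (by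
      intro x _
      obtain ⟨U, hU, hx⟩ := Set.mem_sUnion.1 (hc.symm ▸ Set.mem_univ (σ x) : σ x ∈ ⋃₀ 𝒰)
      exact Set.mem_iUnion.2 ⟨⟨U, hU⟩, hx⟩)
  set D := Metric.diam (Set.univ : Set (stdSimplex ℝ (Fin (n + 1)))) with hD
  set q : ℝ := (((n + 1 : ℕ) : ℝ) - 1) / ((n + 1 : ℕ) : ℝ) with hq
  have hq0 : 0 ≤ q := by rw [hq]; push_cast; simp; positivity
  have hq1 : q < 1 := by
    rw [hq, div_lt_one (by positivity)]; linarith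
  obtain ⟨N, hN⟩ : ∃ N, q ^ N * D < δ := by
    have := (tendsto_pow_atTop_nhds_zero_of_lt_one hq0 hq1).mul_const D
    rw [zero_mul] at this
    exact (this.eventually_lt_const hδ).exists
  refine ⟨N, ?_⟩
  rw [← push_vertices, iterate_sd_push]
  refine Finsupp.supported_comap_lmapDomain ℚ ℚ _ _
    (Finsupp.supported_mono ?_ (iterate_subdiv_mem_meshLE (D := D)
      (Finsupp.single_mem_supported ℚ 1 fun i j => ?_) N))
  · intro w hw
    obtain ⟨U, hU⟩ := hleb (w 0) (Set.mem_univ _)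
    refine ⟨U.1, U.2, ?_⟩
    rintro _ ⟨x, rfl⟩
    exact hU ((affine_mem_closedBall (fun i => hw i 0) x).trans_lt hN)
  · exact Metric.dist_le_diam_of_mem isCompact_univ.isBounded (Set.mem_univ _) (Set.mem_univ _)

lemma exists_iterate_sd_mem_small (ho : ∀ U ∈ 𝒰, IsOpen U) (hc : ⋃₀ 𝒰 = Set.univ)
    (z : Chain X n) : ∃ N, (sd X n)^[N] z ∈ small 𝒰 n := by
  have hpow (N : ℕ) : (sd X n)^[N] = ((sd X n) ^ N : Chain X n →ₗ[ℚ] Chain X n) := by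
    rw [Module.End.coe_pow]
  induction z using Finsupp.induction_linear with
  | zero => exact ⟨0, Submodule.zero_mem _⟩
  | add y z hy hz =>
    obtain ⟨N, hN⟩ := hy
    obtain ⟨M, hM⟩ := hz
    refine ⟨M + N, ?_⟩
    have h1 := iterate_sd_mem_small hN M
    have h2 := iterate_sd_mem_small hM N
    rw [← Function.iterate_add_apply] at h1 h2
    rw [Nat.add_comm N M] at h2
    rw [hpow] at h1 h2 ⊢
    rw [map_add]
    exact Submodule.add_mem _ h1 h2
  | single σ r =>
    obtain ⟨N, hN⟩ := exists_iterate_sd_single_mem_small ho hc σ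
    refine ⟨N, ?_⟩
    rw [hpow] at hN ⊢
    rw [← mul_one r, ← smul_eq_mul, ← Finsupp.smul_single, map_smul]
    exact Submodule.smul_mem _ _ hN

/-- The homotopy shows that a chain with small boundary differs from its subdivisions by a boundary
and a small chain. -/
lemma exists_sub_boundary_sub_iterate_sd_mem_small (z : Chain X (n + 1))
    (hz : boundary X n z ∈ small 𝒰 n) (N : ℕ) :
    ∃ w, z - boundary X (n + 1) w - (sd X (n + 1))^[N] z ∈ small 𝒰 (n + 1) := by
  induction N generalizing z with
  | zero => exact ⟨0, by simp⟩
  | succ N ih =>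
    obtain ⟨w, hw⟩ := ih (sd X (n + 1) z) (by rw [boundary_sd]; exact sd_mem_small hz)
    refine ⟨w + sdHomotopy X (n + 1) z, ?_⟩
    have h := Submodule.add_mem _ hw (sdHomotopy_mem_small hz)
    rw [Function.iterate_succ_apply, map_add]
    convert h using 1
    rw [eq_sub_of_add_eq' (boundary_sdHomotopy z)]
    abel

/-- A chain with small boundary is small modulo boundaries: the singular chains relative to the
small ones are acyclic. -/
theorem exists_sub_boundary_mem_small (ho : ∀ U ∈ 𝒰, IsOpen U) (hc : ⋃₀ 𝒰 = Set.univ)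
    (z : Chain X (n + 1)) (hz : boundary X n z ∈ small 𝒰 n) :
    ∃ w, z - boundary X (n + 1) w ∈ small 𝒰 (n + 1) := by
  obtain ⟨N, hN⟩ := exists_iterate_sd_mem_small ho hc z
  obtain ⟨w, hw⟩ := exists_sub_boundary_sub_iterate_sd_mem_small z hz N
  exact ⟨w, by simpa using Submodule.add_mem _ hw hN⟩

/-- Singular simplices of dimension zero are points, so all chains of degree zero are small. -/
lemma small_zero_eq_top (hc : ⋃₀ 𝒰 = Set.univ) : small 𝒰 0 = ⊤ := by
  refine eq_top_iff.2 fun c _ => (Finsupp.mem_supported ℚ c).2 fun σ _ => ?_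
  obtain ⟨U, hU, hx⟩ := Set.mem_sUnion.1 (hc.symm ▸ Set.mem_univ (σ default) : _ ∈ ⋃₀ 𝒰)
  refine ⟨U, hU, ?_⟩
  rintro _ ⟨x, rfl⟩
  rwa [Subsingleton.elim x default]

end SingularChain

/-! ### The singular chain complex in terms of finitely supported functions -/

namespace SingularChain

open Limits Simplicial

variable {X Y : Type} [TopologicalSpace X] [TopologicalSpace Y] {n : ℕ}

lemma boundary_single (σ : C(stdSimplex ℝ (Fin (n + 2)), X)) :
    boundary X n (Finsupp.single σ 1) =
      ∑ i : Fin (n + 2), (-1 : ℚ) ^ (i : ℕ) • Finsupp.single (face i σ) 1 := by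
  simp [boundary, Finsupp.mapDomain_single]

lemma lsingle_comp_boundary (σ : C(stdSimplex ℝ (Fin (n + 2)), X)) :
    ModuleCat.ofHom (Finsupp.lsingle (R := ℚ) (M := ℚ) σ) ≫ ModuleCat.ofHom (boundary X n) =
      ∑ i : Fin (n + 2), (-1 : ℤ) ^ (i : ℕ) •
        ModuleCat.ofHom (Finsupp.lsingle (R := ℚ) (M := ℚ) (face i σ)) := by
  apply ModuleCat.hom_ext
  ext1
  rw [ModuleCat.hom_sum]
  simp [boundary_single, LinearMap.sum_apply]

lemma boundary_comp_boundary : (boundary X n).comp (boundary X (n + 1)) = 0 := by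
  ext σ : 1
  ext1
  simp only [LinearMap.comp_apply, Finsupp.lsingle_apply, LinearMap.zero_apply]
  rw [← push_vertices, boundary_push, boundary_push, TupleChain.boundary_boundary, map_zero]

/-- The complex of singular chains, as finitely supported functions on the singular simplices. -/
noncomputable def chainComplex (X : Type) [TopologicalSpace X] :
    ChainComplex (ModuleCat.{0} ℚ) ℕ :=
  ChainComplex.of (fun n => ModuleCat.of ℚ (Chain X n)) (fun n => ModuleCat.ofHom (boundary X n))
    fun n => by rw [← ModuleCat.ofHom_comp, boundary_comp_boundary]; rfl

lemma chainComplex_d (n : ℕ) :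
    (chainComplex X).d (n + 1) n = ModuleCat.ofHom (boundary X n) :=
  ChainComplex.of_d (fun n => ModuleCat.of ℚ (Chain X n))
    (fun n => ModuleCat.ofHom (boundary X n)) n

/-- The cofan which exhibits the singular `n`-chains as a coproduct of copies of `ℚ`. -/
noncomputable def cofan (X : Type) [TopologicalSpace X] (n : ℕ) :
    Cofan (fun _ : (TopCat.toSSet.obj (TopCat.of X)) _⦋n⦌ => ModuleCat.of ℚ ℚ) :=
  Cofan.mk (ModuleCat.of ℚ (Chain X n)) fun x =>
    ModuleCat.ofHom (Finsupp.lsingle ((TopCat.of X).toSSetObjEquiv _ x))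

/-- The singular `n`-chains are a coproduct of copies of `ℚ`. -/
noncomputable def isColimitCofan (X : Type) [TopologicalSpace X] (n : ℕ) :
    IsColimit (cofan X n) :=
  Cofan.IsColimit.mk _
    (fun s => ModuleCat.ofHom (Finsupp.lsum ℚ fun σ =>
      (s.inj (((TopCat.of X).toSSetObjEquiv _).symm σ)).hom))
    (fun s x => by
      ext
      simp [cofan])
    (fun s m hm => by
      apply ModuleCat.hom_ext
      refine Finsupp.lhom_ext' fun σ => ?_
      have h := hm (((TopCat.of X).toSSetObjEquiv _).symm σ)
      ext1
      have h1 := ConcreteCategory.congr_hom h (1 : ℚ)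
      simp only [cofan, Cofan.inj, Cofan.mk_ι_app, Equiv.apply_symm_apply] at h1
      refine Eq.trans h1 ?_
      change _ = Finsupp.lsum ℚ (fun σ =>
        (s.inj (((TopCat.of X).toSSetObjEquiv _).symm σ)).hom) (Finsupp.single σ (1 : ℚ))
      rw [Finsupp.lsum_single]
      rfl)

/-- The comparison with Mathlib's singular chain complex, in a fixed degree. -/
noncomputable def chainComplexXIso (X : Type) [TopologicalSpace X] (n : ℕ) :
    ((TopCat.toSSet.obj (TopCat.of X)).chainComplex (ModuleCat.of ℚ ℚ)).X n ≅
      (chainComplex X).X n :=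
  ((TopCat.toSSet.obj (TopCat.of X)).isColimitChainComplexXCofan _ n).coconePointUniqueUpToIso
    (isColimitCofan X n)

lemma ι_chainComplexXIso (x : (TopCat.toSSet.obj (TopCat.of X)) _⦋n⦌) :
    (TopCat.toSSet.obj (TopCat.of X)).ιChainComplex x ≫ (chainComplexXIso X n).hom =
      ModuleCat.ofHom (Finsupp.lsingle ((TopCat.of X).toSSetObjEquiv _ x)) :=
  ((TopCat.toSSet.obj (TopCat.of X)).isColimitChainComplexXCofan (ModuleCat.of ℚ ℚ) n
    ).comp_coconePointUniqueUpToIso_hom (isColimitCofan X n) ⟨x⟩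

/-- Mathlib's singular chain complex is isomorphic to the complex of finitely supported
functions. -/
noncomputable def chainComplexIso (X : Type) [TopologicalSpace X] :
    (TopCat.toSSet.obj (TopCat.of X)).chainComplex (ModuleCat.of ℚ ℚ) ≅ chainComplex X :=
  HomologicalComplex.Hom.isoOfComponents (fun n => chainComplexXIso X n) (by
    rintro i j (rfl : j + 1 = i)
    refine SSet.chainComplex_hom_ext fun x => ?_
    rw [← Category.assoc, ι_chainComplexXIso, chainComplex_d, ← Category.assoc,
      SSet.ιChainComplex_d]
    rw [Preadditive.sum_comp]
    refine (lsingle_comp_boundary _).trans ?_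
    simp only [Preadditive.zsmul_comp, ι_chainComplexXIso]
    rfl)

/-- Rational homology, computed by the complex of finitely supported functions. -/
noncomputable def rationalHomologyIso (X : Type) [TopologicalSpace X] (i : ℕ) :
    rationalHomology X i ≅ (chainComplex X).homology i :=
  (HomologicalComplex.homologyFunctor _ _ i).mapIso (chainComplexIso X)

end SingularChain

/-! ### Mayer–Vietoris sequences of chain complexes -/

/-- There is a long exact sequence `⋯ → K i → L i × M i → N i → K (i - 1) → ⋯`, ending with
`L 0 × M 0 → N 0 → 0`. -/
def HasMayerVietoris (K L M N : ℕ → ModuleCat.{0} ℚ) : Prop :=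
  ∃ (α : ∀ i, K i →ₗ[ℚ] L i × M i) (β : ∀ i, L i × M i →ₗ[ℚ] N i) (δ : ∀ i, N (i + 1) →ₗ[ℚ] K i),
    (∀ i, Function.Exact (α i) (β i)) ∧ (∀ i, Function.Exact (β (i + 1)) (δ i)) ∧
      (∀ i, Function.Exact (δ i) (α i)) ∧ Function.Surjective (β 0)

lemma HasMayerVietoris.congr {K L M N K' L' M' N' : ℕ → ModuleCat.{0} ℚ}
    (h : HasMayerVietoris K L M N) (eK : ∀ i, K i ≃ₗ[ℚ] K' i) (eL : ∀ i, L i ≃ₗ[ℚ] L' i)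
    (eM : ∀ i, M i ≃ₗ[ℚ] M' i) (eN : ∀ i, N i ≃ₗ[ℚ] N' i) : HasMayerVietoris K' L' M' N' := by
  obtain ⟨α, β, δ, h₁, h₂, h₃, h₄⟩ := h
  refine ⟨fun i => ((eL i).prodCongr (eM i)).toLinearMap ∘ₗ α i ∘ₗ (eK i).symm.toLinearMap,
    fun i => (eN i).toLinearMap ∘ₗ β i ∘ₗ ((eL i).prodCongr (eM i)).symm.toLinearMap,
    fun i => (eK i).toLinearMap ∘ₗ δ i ∘ₗ (eN (i + 1)).symm.toLinearMap,
    fun i => ?_, fun i => ?_, fun i => ?_, ?_⟩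
  · refine (Function.Exact.iff_of_ladder_linearEquiv (e₁ := eK i)
      (e₂ := (eL i).prodCongr (eM i)) (e₃ := eN i) ?_ ?_).2 (h₁ i) <;> ext x <;> simp
  · refine (Function.Exact.iff_of_ladder_linearEquiv (e₁ := (eL (i + 1)).prodCongr (eM (i + 1)))
      (e₂ := eN (i + 1)) (e₃ := eK i) ?_ ?_).2 (h₂ i) <;> ext x <;> simp
  · refine (Function.Exact.iff_of_ladder_linearEquiv (e₁ := eN (i + 1))
      (e₂ := eK i) (e₃ := (eL i).prodCongr (eM i)) ?_ ?_).2 (h₃ i) <;> ext x <;> simp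
  · exact (eN 0).surjective.comp (h₄.comp (LinearEquiv.surjective _))

section

open Limits HomologicalComplex

variable {K L M N : ChainComplex (ModuleCat.{0} ℚ) ℕ}

/-- The homology of a direct sum of complexes. -/
noncomputable def homologyBiprodEquiv (L M : ChainComplex (ModuleCat.{0} ℚ) ℕ) (i : ℕ) :
    (L ⊞ M).homology i ≃ₗ[ℚ] L.homology i × M.homology i :=
  LinearEquiv.ofLinearMap
    ((homologyMap (biprod.fst : L ⊞ M ⟶ L) i).hom.prod
      (homologyMap (biprod.snd : L ⊞ M ⟶ M) i).hom)
    ((homologyMap (biprod.inl : L ⟶ L ⊞ M) i).hom.coprod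
      (homologyMap (biprod.inr : M ⟶ L ⊞ M) i).hom)
    (by
      ext x <;>
      simp [← ModuleCat.comp_apply, ← homologyMap_comp])
    (by
      have h : homologyMap (biprod.fst ≫ biprod.inl + biprod.snd ≫ biprod.inr : L ⊞ M ⟶ L ⊞ M) i
          = 𝟙 _ := by rw [biprod.total, homologyMap_id]
      rw [homologyMap_add, homologyMap_comp, homologyMap_comp] at h
      ext x
      exact ConcreteCategory.congr_hom h x)

lemma function_exact_of_exact {A B C : ModuleCat.{0} ℚ} {f : A ⟶ B} {g : B ⟶ C} {w : f ≫ g = 0}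
    (h : (ShortComplex.mk f g w).Exact) : Function.Exact f.hom g.hom :=
  LinearMap.exact_iff.2 h.moduleCat_range_eq_ker.symm

/-- The Mayer–Vietoris sequence of a square of complexes which is a pullback and a pushout. -/
theorem hasMayerVietoris_homology (iL : K ⟶ L) (iM : K ⟶ M) (jL : L ⟶ N) (jM : M ⟶ N)
    (comm : iL ≫ jL = iM ≫ jM) (hinj : ∀ n, Function.Injective (iL.f n).hom)
    (hex : ∀ n a b, (jL.f n).hom a = (jM.f n).hom b →
      ∃ c, (iL.f n).hom c = a ∧ (iM.f n).hom c = b)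
    (hsurj : ∀ n y, ∃ a b, (jL.f n).hom a + (jM.f n).hom b = y) :
    HasMayerVietoris (fun i => K.homology i) (fun i => L.homology i) (fun i => M.homology i)
      fun i => N.homology i := by
  let S : ShortComplex (ChainComplex (ModuleCat.{0} ℚ) ℕ) :=
    ShortComplex.mk (biprod.lift iL (-iM)) (biprod.desc jL jM) (by simp [comm])
  have apply_comp {A B C : ChainComplex (ModuleCat.{0} ℚ) ℕ} (f : A ⟶ B) (g : B ⟶ C) (n : ℕ)
      (x : A.X n) : (g.f n).hom ((f.f n).hom x) = ((f ≫ g).f n).hom x := rfl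
  have hdecomp (n : ℕ) (x : (L ⊞ M).X n) :
      x = ((biprod.inl : L ⟶ L ⊞ M).f n).hom (((biprod.fst : L ⊞ M ⟶ L).f n).hom x) +
        ((biprod.inr : M ⟶ L ⊞ M).f n).hom (((biprod.snd : L ⊞ M ⟶ M).f n).hom x) := by
    have h : (biprod.fst ≫ biprod.inl + biprod.snd ≫ biprod.inr : L ⊞ M ⟶ L ⊞ M).f n = 𝟙 _ := by
      rw [biprod.total]; rfl
    exact (ConcreteCategory.congr_hom h x).symm
  have hS : S.ShortExact := by
    refine shortExact_of_degreewise_shortExact S fun n => ?_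
    refine ModuleCat.shortComplex_shortExact _ (fun (x : (L ⊞ M).X n) => ?_)
      (fun (x y : K.X n) hxy => ?_) (fun y => ?_)
    · constructor
      · intro hx
        obtain ⟨c, hc₁, hc₂⟩ := hex n (((biprod.fst : L ⊞ M ⟶ L).f n).hom x)
          (-((biprod.snd : L ⊞ M ⟶ M).f n).hom x) (by
            rw [map_neg, eq_neg_iff_add_eq_zero]
            have h : ((biprod.desc jL jM).f n).hom x = 0 := hx
            rw [hdecomp n x, map_add, apply_comp biprod.inl, apply_comp biprod.inr,
              biprod.inl_desc, biprod.inr_desc] at h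
            exact h)
        refine ⟨c, ?_⟩
        change ((biprod.lift iL (-iM)).f n).hom c = x
        rw [hdecomp n (((biprod.lift iL (-iM)).f n).hom c), apply_comp _ biprod.fst,
          apply_comp _ biprod.snd, biprod.lift_fst, biprod.lift_snd, hc₁]
        have : ((-iM).f n).hom c = ((biprod.snd : L ⊞ M ⟶ M).f n).hom x := by
          rw [HomologicalComplex.neg_f_apply, ModuleCat.hom_neg, LinearMap.neg_apply, hc₂, neg_neg]
        rw [this, ← hdecomp]
      · rintro ⟨y, rfl⟩
        exact ConcreteCategory.congr_hom (congr_arg (fun f => f.f n) S.zero) y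
    · apply hinj n
      have h : ((biprod.fst : L ⊞ M ⟶ L).f n).hom (((biprod.lift iL (-iM)).f n).hom x) =
        ((biprod.fst : L ⊞ M ⟶ L).f n).hom (((biprod.lift iL (-iM)).f n).hom y) :=
        congr_arg _ hxy
      rwa [apply_comp, apply_comp, biprod.lift_fst] at h
    · obtain ⟨a, b, rfl⟩ := hsurj n y
      refine ⟨((biprod.inl : L ⟶ L ⊞ M).f n).hom a + ((biprod.inr : M ⟶ L ⊞ M).f n).hom b, ?_⟩
      change ((biprod.desc jL jM).f n).hom _ = _
      rw [map_add, apply_comp, apply_comp, biprod.inl_desc, biprod.inr_desc]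
  have rel (i : ℕ) : (ComplexShape.down ℕ).Rel (i + 1) i := rfl
  refine ⟨fun i => (homologyBiprodEquiv L M i).toLinearMap ∘ₗ (homologyMap S.f i).hom,
    fun i => (homologyMap S.g i).hom ∘ₗ (homologyBiprodEquiv L M i).symm.toLinearMap,
    fun i => (hS.δ (i + 1) i (rel i)).hom, fun i => ?_, fun i => ?_, fun i => ?_, ?_⟩
  · have := function_exact_of_exact (hS.homology_exact₂ i)
    refine (Function.Exact.iff_of_ladder_linearEquiv (e₁ := LinearEquiv.refl _ _)
      (e₂ := homologyBiprodEquiv L M i) (e₃ := LinearEquiv.refl _ _) ?_ ?_).2 this <;>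
    ext x <;> simp
  · have := function_exact_of_exact (hS.homology_exact₃ (i + 1) i (rel i))
    refine (Function.Exact.iff_of_ladder_linearEquiv (e₁ := homologyBiprodEquiv L M (i + 1))
      (e₂ := LinearEquiv.refl _ _) (e₃ := LinearEquiv.refl _ _) ?_ ?_).2 this <;>
    ext x <;> simp
  · have := function_exact_of_exact (hS.homology_exact₁ (i + 1) i (rel i))
    refine (Function.Exact.iff_of_ladder_linearEquiv (e₁ := LinearEquiv.refl _ _)
      (e₂ := LinearEquiv.refl _ _) (e₃ := homologyBiprodEquiv L M i) ?_ ?_).2 this <;>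
    ext x <;> simp
  · have := hS.epi_g
    have : Epi (homologyMap S.g 0) := epi_homologyMap_of_epi_of_not_rel S.g 0 (by simp)
    exact ((ModuleCat.epi_iff_surjective _).1 this).comp (LinearEquiv.surjective _)

/-! ### Subcomplexes -/

variable (C : ChainComplex (ModuleCat.{0} ℚ) ℕ) (S : ∀ n, Submodule ℚ (C.X n))
  (hS : ∀ n, ∀ x ∈ S (n + 1), (C.d (n + 1) n).hom x ∈ S n)

/-- The subcomplex given by submodules stable under the differential. -/
noncomputable def subcomplex : ChainComplex (ModuleCat.{0} ℚ) ℕ :=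
  ChainComplex.of (fun n => ModuleCat.of ℚ (S n))
    (fun n => ModuleCat.ofHom ((C.d (n + 1) n).hom.restrict (hS n))) fun n => by
      apply ModuleCat.hom_ext
      ext x
      exact ConcreteCategory.congr_hom (C.d_comp_d (n + 2) (n + 1) n) x.1

lemma subcomplex_d (n : ℕ) : (subcomplex C S hS).d (n + 1) n =
    ModuleCat.ofHom ((C.d (n + 1) n).hom.restrict (hS n)) :=
  ChainComplex.of_d (fun n => ModuleCat.of ℚ (S n))
    (fun n => ModuleCat.ofHom ((C.d (n + 1) n).hom.restrict (hS n))) n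

/-- The inclusion of a subcomplex. -/
noncomputable def subcomplexι : subcomplex C S hS ⟶ C where
  f n := ModuleCat.ofHom (S n).subtype
  comm' := by
    rintro i j (rfl : j + 1 = i)
    rw [subcomplex_d]
    rfl

/-- The factorization of a map of complexes through a subcomplex. -/
noncomputable def subcomplexLift {K : ChainComplex (ModuleCat.{0} ℚ) ℕ} (φ : K ⟶ C)
    (h : ∀ n x, (φ.f n).hom x ∈ S n) : K ⟶ subcomplex C S hS where
  f n := ModuleCat.ofHom ((φ.f n).hom.codRestrict (S n) (h n))
  comm' := by
    rintro i j (rfl : j + 1 = i)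
    rw [subcomplex_d]
    apply ModuleCat.hom_ext
    ext x
    apply Subtype.ext
    exact ConcreteCategory.congr_hom (φ.comm (j + 1) j) x

lemma subcomplex_hom_ext {K : ChainComplex (ModuleCat.{0} ℚ) ℕ} {f g : K ⟶ subcomplex C S hS}
    (h : f ≫ subcomplexι C S hS = g ≫ subcomplexι C S hS) : f = g := by
  apply HomologicalComplex.hom_ext
  intro n
  apply ModuleCat.hom_ext
  refine LinearMap.ext fun x => Subtype.ext ?_
  exact ConcreteCategory.congr_hom (congr_arg (fun f => f.f n) h) x

/-- The quotient by a subcomplex. -/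
noncomputable def quotientComplex : ChainComplex (ModuleCat.{0} ℚ) ℕ :=
  ChainComplex.of (fun n => ModuleCat.of ℚ (C.X n ⧸ S n))
    (fun n => ModuleCat.ofHom ((S (n + 1)).mapQ (S n) (C.d (n + 1) n).hom (hS n))) fun n => by
      apply ModuleCat.hom_ext
      refine Submodule.linearMap_qext _ ?_
      ext x
      have h : (C.d (n + 1) n).hom ((C.d (n + 2) (n + 1)).hom x) = 0 :=
        ConcreteCategory.congr_hom (C.d_comp_d (n + 2) (n + 1) n) x
      change Submodule.Quotient.mk ((C.d (n + 1) n).hom ((C.d (n + 2) (n + 1)).hom x)) = _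
      rw [h]
      rfl

lemma quotientComplex_d (n : ℕ) : (quotientComplex C S hS).d (n + 1) n =
    ModuleCat.ofHom ((S (n + 1)).mapQ (S n) (C.d (n + 1) n).hom (hS n)) :=
  ChainComplex.of_d (fun n => ModuleCat.of ℚ (C.X n ⧸ S n))
    (fun n => ModuleCat.ofHom ((S (n + 1)).mapQ (S n) (C.d (n + 1) n).hom (hS n))) n

/-- The projection to the quotient by a subcomplex. -/
noncomputable def quotientComplexπ : C ⟶ quotientComplex C S hS where
  f n := ModuleCat.ofHom (S n).mkQ
  comm' := by
    rintro i j (rfl : j + 1 = i)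
    rw [quotientComplex_d]
    rfl

variable {C S}

/-- A subcomplex has the same homology as the ambient complex if every relative cycle is a
boundary modulo the subcomplex. -/
theorem nonempty_homology_subcomplex_equiv (h₀ : S 0 = ⊤)
    (h : ∀ n (z : C.X (n + 1)), (C.d (n + 1) n).hom z ∈ S n →
      ∃ w, z - (C.d (n + 2) (n + 1)).hom w ∈ S (n + 1)) (i : ℕ) :
    Nonempty ((subcomplex C S hS).homology i ≃ₗ[ℚ] C.homology i) := by
  let T : ShortComplex (ChainComplex (ModuleCat.{0} ℚ) ℕ) :=
    ShortComplex.mk (subcomplexι C S hS) (quotientComplexπ C S hS) (by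
      ext n x
      exact (Submodule.Quotient.mk_eq_zero _).2 x.2)
  have hT : T.ShortExact := by
    refine shortExact_of_degreewise_shortExact T fun n => ?_
    refine ModuleCat.shortComplex_shortExact _ (fun (x : C.X n) => ?_) Subtype.val_injective
      (Submodule.Quotient.mk_surjective (S n))
    exact (Submodule.Quotient.mk_eq_zero (S n)).trans
      ⟨fun hx => ⟨⟨x, hx⟩, rfl⟩, by rintro ⟨y, rfl⟩; exact y.2⟩
  have hQ (n : ℕ) : Subsingleton ((quotientComplex C S hS).homology n) := by
    have : (quotientComplex C S hS).ExactAt n := by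
      cases n with
      | zero =>
        rw [exactAt_iff' _ 1 0 0 (by simp) (by simp), ShortComplex.moduleCat_exact_iff]
        intro x _
        obtain ⟨x, rfl⟩ := Submodule.Quotient.mk_surjective _ x
        refine ⟨0, (map_zero _).trans ((Submodule.Quotient.mk_eq_zero _).2 ?_).symm⟩
        rw [h₀]; trivial
      | succ n =>
        rw [exactAt_iff' _ (n + 2) (n + 1) n (by simp) (by simp), ShortComplex.moduleCat_exact_iff]
        intro x hx
        obtain ⟨x, rfl⟩ := Submodule.Quotient.mk_surjective _ x
        change ((quotientComplex C S hS).d (n + 1) n).hom _ = 0 at hx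
        rw [quotientComplex_d] at hx
        obtain ⟨w, hw⟩ := h n x ((Submodule.Quotient.mk_eq_zero _).1 hx)
        refine ⟨Submodule.Quotient.mk w, ?_⟩
        change ((quotientComplex C S hS).d (n + 2) (n + 1)).hom _ = _
        rw [quotientComplex_d]
        exact ((Submodule.Quotient.eq _).2 hw).symm
    exact ModuleCat.subsingleton_of_isZero this.isZero_homology
  refine ⟨LinearEquiv.ofBijective (homologyMap T.f i).hom ⟨?_, ?_⟩⟩
  · rw [← LinearMap.ker_eq_bot,
      LinearMap.exact_iff.1 (function_exact_of_exact (hT.homology_exact₁ (i + 1) i rfl)),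
      LinearMap.range_eq_bot]
    ext x
    rw [Subsingleton.elim x 0, map_zero, map_zero]
  · rw [← LinearMap.range_eq_top,
      ← LinearMap.exact_iff.1 (function_exact_of_exact (hT.homology_exact₂ i)),
      LinearMap.ker_eq_top]
    ext x
    exact Subsingleton.elim _ _

end

/-! ### The Mayer–Vietoris sequence of an open cover -/

namespace SingularChain

variable {X Y Z : Type} [TopologicalSpace X] [TopologicalSpace Y] [TopologicalSpace Z]

/-- The map on singular chains induced by a continuous map. -/
noncomputable def chainMap (f : C(X, Y)) (n : ℕ) : Chain X n →ₗ[ℚ] Chain Y n :=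
  Finsupp.lmapDomain ℚ ℚ f.comp

lemma boundary_chainMap (f : C(X, Y)) (n : ℕ) :
    (boundary Y n).comp (chainMap f (n + 1)) = (chainMap f n).comp (boundary X n) := by
  ext σ : 1
  ext1
  simp only [LinearMap.comp_apply, Finsupp.lsingle_apply, boundary_single, map_sum, map_smul,
    chainMap, Finsupp.lmapDomain_apply, Finsupp.mapDomain_single]
  rfl

lemma chainMap_chainMap (f : C(X, Y)) (g : C(Y, Z)) (n : ℕ) (c : Chain X n) :
    chainMap g n (chainMap f n c) = chainMap (g.comp f) n c := by
  simp only [chainMap, Finsupp.lmapDomain_apply, ← Finsupp.mapDomain_comp]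
  rfl

/-- The map of singular chain complexes induced by a continuous map. -/
noncomputable def chainComplexMap (f : C(X, Y)) : chainComplex X ⟶ chainComplex Y where
  f n := ModuleCat.ofHom (chainMap f n)
  comm' := by
    rintro i j (rfl : j + 1 = i)
    rw [chainComplex_d, chainComplex_d]
    exact congr_arg ModuleCat.ofHom (boundary_chainMap f j)

/-- The inclusion of a subspace. -/
def incl (U : Set X) : C(U, X) := ⟨Subtype.val, continuous_subtype_val⟩

/-- The inclusion of a subspace in a larger one. -/
def inclOfSubset {U V : Set X} (h : U ⊆ V) : C(U, V) := ⟨Set.inclusion h, continuous_inclusion h⟩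

lemma chainMap_incl_injective (U : Set X) (n : ℕ) : Function.Injective (chainMap (incl U) n) := by
  refine Finsupp.mapDomain_injective fun σ τ h => ?_
  ext x
  exact congr_arg (fun f => f x) h

lemma range_chainMap_incl (U : Set X) (n : ℕ) :
    LinearMap.range (chainMap (incl U) n) =
      Finsupp.supported ℚ ℚ {σ : C(stdSimplex ℝ (Fin (n + 1)), X) | Set.range σ ⊆ U} := by
  rw [← Submodule.map_top, ← Finsupp.supported_univ, chainMap, Finsupp.lmapDomain_supported]
  congr 1
  ext σ
  constructor
  · rintro ⟨τ, -, rfl⟩ _ ⟨x, rfl⟩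
    exact (τ x).2
  · intro h
    exact ⟨⟨fun x => ⟨σ x, h ⟨x, rfl⟩⟩, by fun_prop⟩, trivial, rfl⟩

lemma boundary_mem_small (𝒰 : Set (Set X)) (n : ℕ) (c : Chain X (n + 1))
    (hc : c ∈ small 𝒰 (n + 1)) :
    boundary X n c ∈ small 𝒰 n := by
  rw [boundary, LinearMap.sum_apply]
  refine Submodule.sum_mem _ fun i _ => Submodule.smul_mem _ _ ?_
  refine Finsupp.supported_comap_lmapDomain ℚ ℚ _ _ (Finsupp.supported_mono ?_ hc)
  rintro σ ⟨U, hU, h⟩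
  exact ⟨U, hU, (Set.range_comp_subset_range _ σ).trans h⟩

lemma exists_add_eq_of_mem_small_pair {U V : Set X} {n : ℕ} {y : Chain X n}
    (hy : y ∈ small {U, V} n) :
    ∃ (a : Chain U n) (b : Chain V n), chainMap (incl U) n a + chainMap (incl V) n b = y := by
  have h : small {U, V} n =
      LinearMap.range (chainMap (incl U) n) ⊔ LinearMap.range (chainMap (incl V) n) := by
    rw [range_chainMap_incl, range_chainMap_incl, ← Finsupp.supported_union]
    refine congr_arg _ (Set.ext fun σ => ?_)
    simp [smallSimplices]
  rw [h] at hy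
  obtain ⟨_, ⟨a, rfl⟩, _, ⟨b, rfl⟩, h⟩ := Submodule.mem_sup.1 hy
  exact ⟨a, b, h⟩

/-- The complex of the chains which are small with respect to a cover. -/
noncomputable def smallComplex (𝒰 : Set (Set X)) : ChainComplex (ModuleCat.{0} ℚ) ℕ :=
  subcomplex (chainComplex X) (small 𝒰) fun n x hx => by
    rw [chainComplex_d]; exact boundary_mem_small 𝒰 n x hx

/-- The inclusion of the small chains. -/
noncomputable def smallComplexι (𝒰 : Set (Set X)) : smallComplex 𝒰 ⟶ chainComplex X :=
  subcomplexι _ _ _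

lemma smallComplex_hom_ext {K : ChainComplex (ModuleCat.{0} ℚ) ℕ} {𝒰 : Set (Set X)}
    {f g : K ⟶ smallComplex 𝒰} (h : f ≫ smallComplexι 𝒰 = g ≫ smallComplexι 𝒰) : f = g :=
  subcomplex_hom_ext _ _ _ h

lemma nonempty_homology_smallComplex_equiv {𝒰 : Set (Set X)} (ho : ∀ U ∈ 𝒰, IsOpen U)
    (hc : ⋃₀ 𝒰 = Set.univ) (i : ℕ) :
    Nonempty ((smallComplex 𝒰).homology i ≃ₗ[ℚ] (chainComplex X).homology i) := by
  refine nonempty_homology_subcomplex_equiv _ (small_zero_eq_top hc) (fun n z hz => ?_) i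
  rw [chainComplex_d] at hz
  rw [chainComplex_d]
  exact exists_sub_boundary_mem_small ho hc z hz

lemma chainComplexMap_comp (f : C(X, Y)) (g : C(Y, Z)) :
    chainComplexMap f ≫ chainComplexMap g = chainComplexMap (g.comp f) := by
  apply HomologicalComplex.hom_ext
  intro n
  apply ModuleCat.hom_ext
  exact LinearMap.ext (chainMap_chainMap f g n)

lemma chainMap_incl_mem_small {𝒰 : Set (Set X)} {U : Set X} (hU : U ∈ 𝒰) (n : ℕ) (x : Chain U n) :
    chainMap (incl U) n x ∈ small 𝒰 n := by
  have h : chainMap (incl U) n x ∈ LinearMap.range (chainMap (incl U) n) := ⟨x, rfl⟩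
  rw [range_chainMap_incl] at h
  have hle : {σ : C(stdSimplex ℝ (Fin (n + 1)), X) | Set.range σ ⊆ U} ⊆ smallSimplices 𝒰 n :=
    fun σ hσ => ⟨U, hU, hσ⟩
  exact Finsupp.supported_mono hle h

/-- The singular chains of a member of a cover are small. -/
noncomputable def toSmallComplex {𝒰 : Set (Set X)} {U : Set X} (hU : U ∈ 𝒰) :
    chainComplex U ⟶ smallComplex 𝒰 :=
  subcomplexLift _ _ _ (chainComplexMap (incl U)) (chainMap_incl_mem_small hU)

lemma toSmallComplex_ι {𝒰 : Set (Set X)} {U : Set X} (hU : U ∈ 𝒰) :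
    toSmallComplex hU ≫ smallComplexι 𝒰 = chainComplexMap (incl U) := rfl

lemma exists_chainMap_inclOfSubset_eq {U V : Set X} {n : ℕ} {a : Chain U n} {b : Chain V n}
    (hab : chainMap (incl U) n a = chainMap (incl V) n b) :
    ∃ c : Chain ↥(U ∩ V) n, chainMap (inclOfSubset Set.inter_subset_left) n c = a ∧
      chainMap (inclOfSubset Set.inter_subset_right) n c = b := by
  have hmem : chainMap (incl U) n a ∈ LinearMap.range (chainMap (incl (U ∩ V)) n) := by
    have h₁ : chainMap (incl U) n a ∈ LinearMap.range (chainMap (incl U) n) := ⟨a, rfl⟩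
    have h₂ : chainMap (incl U) n a ∈ LinearMap.range (chainMap (incl V) n) := ⟨b, hab.symm⟩
    rw [range_chainMap_incl] at h₁ h₂ ⊢
    have := Submodule.mem_inf.2 ⟨h₁, h₂⟩
    rw [← Finsupp.supported_inter] at this
    refine Finsupp.supported_mono ?_ this
    rintro σ ⟨h, h'⟩
    exact Set.subset_inter h h'
  obtain ⟨c, hc⟩ := hmem
  refine ⟨c, chainMap_incl_injective U n ?_, chainMap_incl_injective V n ?_⟩
  · exact (chainMap_chainMap _ _ n c).trans hc
  · exact (chainMap_chainMap _ _ n c).trans (hc.trans hab)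

lemma chainMap_inclOfSubset_injective {U V : Set X} (h : U ⊆ V) (n : ℕ) :
    Function.Injective (chainMap (inclOfSubset h) n) := by
  refine Finsupp.mapDomain_injective fun σ τ hστ => ?_
  ext x
  exact congr_arg (fun f => (f x).1) hστ

lemma chainComplexMap_comp_toSmallComplex {𝒰 : Set (Set X)} {U V W : Set X} (hU : U ∈ 𝒰)
    (hV : V ∈ 𝒰) (h : W ⊆ U) (h' : W ⊆ V) :
    chainComplexMap (inclOfSubset h) ≫ toSmallComplex hU =
      chainComplexMap (inclOfSubset h') ≫ toSmallComplex hV := by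
  apply smallComplex_hom_ext
  rw [Category.assoc, Category.assoc, toSmallComplex_ι, toSmallComplex_ι, chainComplexMap_comp,
    chainComplexMap_comp]
  rfl

lemma exists_toSmallComplex_add_eq (U V : Set X) (n : ℕ) (y : (smallComplex {U, V}).X n) :
    ∃ a b, ((toSmallComplex (Set.mem_insert U {V})).f n).hom a +
      ((toSmallComplex (Set.mem_insert_of_mem U (Set.mem_singleton V))).f n).hom b = y := by
  obtain ⟨a, b, h⟩ := exists_add_eq_of_mem_small_pair (Subtype.property y)
  exact ⟨a, b, Subtype.ext h⟩

/-- The short exact sequence of singular chains on a pair of subsets, on their intersection, and of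
small chains gives a Mayer–Vietoris sequence. -/
theorem hasMayerVietoris_smallComplex (U V : Set X) :
    HasMayerVietoris (fun i => (chainComplex ↥(U ∩ V)).homology i)
      (fun i => (chainComplex U).homology i) (fun i => (chainComplex V).homology i)
      (fun i => (smallComplex {U, V}).homology i) :=
  hasMayerVietoris_homology (chainComplexMap (inclOfSubset Set.inter_subset_left))
    (chainComplexMap (inclOfSubset Set.inter_subset_right))
    (toSmallComplex (Set.mem_insert U {V}))
    (toSmallComplex (Set.mem_insert_of_mem U (Set.mem_singleton V)))
    (chainComplexMap_comp_toSmallComplex _ _ _ _)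
    (fun n => chainMap_inclOfSubset_injective _ n)
    (fun _ _ _ hab => exists_chainMap_inclOfSubset_eq (congr_arg Subtype.val hab))
    (exists_toSmallComplex_add_eq U V)

end SingularChain

open SingularChain in
/-- The Mayer–Vietoris sequence of a cover by two open subsets. -/
theorem hasMayerVietoris_of_isOpen {X : Type} [TopologicalSpace X] {U V : Set X} (hU : IsOpen U)
    (hV : IsOpen V) (hUV : U ∪ V = Set.univ) :
    HasMayerVietoris (rationalHomology ↥(U ∩ V)) (rationalHomology U) (rationalHomology V)
      (rationalHomology X) := by
  have ho : ∀ W ∈ ({U, V} : Set (Set X)), IsOpen W := by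
    rintro W (rfl | rfl) <;> assumption
  have hc : ⋃₀ ({U, V} : Set (Set X)) = Set.univ := by rw [Set.sUnion_pair, hUV]
  exact (hasMayerVietoris_smallComplex U V).congr
    (K' := rationalHomology ↥(U ∩ V)) (L' := rationalHomology U) (M' := rationalHomology V)
    (N' := rationalHomology X)
    (fun i => (rationalHomologyIso _ i).symm.toLinearEquiv)
    (fun i => (rationalHomologyIso _ i).symm.toLinearEquiv)
    (fun i => (rationalHomologyIso _ i).symm.toLinearEquiv)
    (fun i => (nonempty_homology_smallComplex_equiv ho hc i).some.trans
      (rationalHomologyIso _ i).symm.toLinearEquiv)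

/-! ### Betti numbers -/

/-- The rational homology of `X` is finite-dimensional in each degree, with Betti numbers `b`. -/
def HasBetti (X : Type) [TopologicalSpace X] (b : ℕ → ℕ) : Prop :=
  ∀ i, Module.Finite ℚ (rationalHomology X i) ∧ bettiNumber X i = b i

section Betti

open scoped ContinuousMap

variable {X Y : Type} [TopologicalSpace X] [TopologicalSpace Y] {b : ℕ → ℕ}

/-- Homotopy equivalent spaces have isomorphic rational homology. -/
noncomputable def rationalHomologyEquivOfHomotopyEquiv (e : X ≃ₕ Y) (i : ℕ) :
    rationalHomology X i ≃ₗ[ℚ] rationalHomology Y i :=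
  let F := (singularHomologyFunctor (ModuleCat.{0} ℚ) i).obj (ModuleCat.of ℚ ℚ)
  have h {Z : Type} [TopologicalSpace Z] {f : C(Z, Z)} (H : f.Homotopic (ContinuousMap.id Z)) :
      F.map (TopCat.ofHom f) = 𝟙 (F.obj (TopCat.of Z)) := by
    rw [← F.map_id]
    exact TopCat.Homotopy.congr_homologyMap_singularChainComplexFunctor
      (f := TopCat.ofHom f) (g := 𝟙 (TopCat.of Z)) H.some _ _
  Iso.toLinearEquiv
    { hom := F.map (TopCat.ofHom e.toFun)
      inv := F.map (TopCat.ofHom e.invFun)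
      hom_inv_id := by rw [← F.map_comp, ← TopCat.ofHom_comp, h e.left_inv]
      inv_hom_id := by rw [← F.map_comp, ← TopCat.ofHom_comp, h e.right_inv] }

lemma HasBetti.of_homotopyEquiv (h : HasBetti Y b) (e : X ≃ₕ Y) : HasBetti X b := fun i =>
  have := (h i).1
  ⟨Module.Finite.equiv (rationalHomologyEquivOfHomotopyEquiv e i).symm,
    (rationalHomologyEquivOfHomotopyEquiv e i).finrank_eq.trans (h i).2⟩

lemma HasBetti.of_homeomorph (h : HasBetti Y b) (e : X ≃ₜ Y) : HasBetti X b :=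
  h.of_homotopyEquiv e.toHomotopyEquiv

lemma bettiNumber_zero_of_pathConnectedSpace [PathConnectedSpace X] : bettiNumber X 0 = 1 := by
  have : PathConnectedSpace (TopCat.of X) := ‹_›
  have e := (asIso ((TopCat.of X).singularHomology₀ε (ModuleCat.of ℚ ℚ))).toLinearEquiv
  exact e.finrank_eq.trans (Module.finrank_self ℚ)

lemma hasBetti_of_isEmpty [IsEmpty X] : HasBetti X fun _ => 0 := by
  have h (i : ℕ) : Subsingleton (rationalHomology X i) := by
    have : IsEmpty (TopCat.of X) := ‹_›
    cases i with
    | zero =>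
      have e := singularHomologyFunctorZeroOfTotallyDisconnectedSpace (ModuleCat.{0} ℚ)
        (ModuleCat.of ℚ ℚ) (TopCat.of X)
      refine ModuleCat.subsingleton_of_isZero (Limits.IsZero.of_iso ?_ e)
      rw [Limits.IsZero.iff_id_eq_zero]
      exact Limits.Sigma.hom_ext _ _ fun x => isEmptyElim x
    | succ i =>
      exact ModuleCat.subsingleton_of_isZero
        (isZero_singularHomologyFunctor_of_totallyDisconnectedSpace (ModuleCat.{0} ℚ) (i + 1)
          (ModuleCat.of ℚ ℚ) (TopCat.of X) i.succ_ne_zero)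
  intro i
  have := h i
  exact ⟨inferInstance, Module.finrank_zero_of_subsingleton⟩

lemma hasBetti_of_contractibleSpace [ContractibleSpace X] :
    HasBetti X fun i => if i = 0 then 1 else 0 := by
  refine HasBetti.of_homotopyEquiv ?_ (ContractibleSpace.hequiv_unit X).some
  intro i
  have : TotallyDisconnectedSpace (TopCat.of Unit) :=
    inferInstanceAs (TotallyDisconnectedSpace Unit)
  cases i with
  | zero =>
    have : PathConnectedSpace (TopCat.of Unit) := inferInstanceAs (PathConnectedSpace Unit)
    have e := (asIso ((TopCat.of Unit).singularHomology₀ε (ModuleCat.of ℚ ℚ))).toLinearEquiv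
    exact ⟨Module.Finite.equiv e.symm, bettiNumber_zero_of_pathConnectedSpace⟩
  | succ i =>
    have : Subsingleton (rationalHomology Unit (i + 1)) := ModuleCat.subsingleton_of_isZero
        (isZero_singularHomologyFunctor_of_totallyDisconnectedSpace (ModuleCat.{0} ℚ) (i + 1)
          (ModuleCat.of ℚ ℚ) (TopCat.of Unit) i.succ_ne_zero)
    exact ⟨inferInstance, Module.finrank_zero_of_subsingleton⟩

/-- The count of dimensions in a Mayer–Vietoris sequence. Here `r i` is the rank of the map from the
homology in degree `i` of the intersection to the homology of the two pieces. -/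
theorem HasBetti.exists_of_union {U V : Set X} (hU : IsOpen U) (hV : IsOpen V)
    (hUV : U ∪ V = Set.univ) {k l m : ℕ → ℕ} (hk : HasBetti ↥(U ∩ V) k) (hl : HasBetti U l)
    (hm : HasBetti V m) :
    ∃ n r : ℕ → ℕ, HasBetti X n ∧ (∀ i, r i ≤ k i) ∧ (∀ i, r i ≤ l i + m i) ∧
      n 0 + r 0 = l 0 + m 0 ∧
      ∀ i, n (i + 1) + r (i + 1) + r i = l (i + 1) + m (i + 1) + k i := by
  obtain ⟨α, β, δ, h₁, h₂, h₃, h₄⟩ := hasMayerVietoris_of_isOpen hU hV hUV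
  have _ (i : ℕ) := (hk i).1
  have _ (i : ℕ) := (hl i).1
  have _ (i : ℕ) := (hm i).1
  have hN (i : ℕ) : Module.Finite ℚ (rationalHomology X i) := by
    cases i with
    | zero => exact Module.Finite.of_surjective (β 0) h₄
    | succ i =>
      have : Module.Finite ℚ (LinearMap.ker (δ i)) := by
        rw [LinearMap.exact_iff.1 (h₂ i)]; infer_instance
      have := Module.Finite.equiv (δ i).quotKerEquivRange.symm
      exact Module.Finite.of_submodule_quotient (LinearMap.ker (δ i))
  have hprod (i : ℕ) : Module.finrank ℚ (rationalHomology U i × rationalHomology V i) =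
      l i + m i := by
    rw [Module.finrank_prod]; exact congr_arg₂ _ (hl i).2 (hm i).2
  have hα (i : ℕ) : Module.finrank ℚ (LinearMap.range (α i)) +
      Module.finrank ℚ (LinearMap.ker (α i)) = k i :=
    (LinearMap.finrank_range_add_finrank_ker (α i)).trans (hk i).2
  have hβ (i : ℕ) : Module.finrank ℚ (LinearMap.range (β i)) +
      Module.finrank ℚ (LinearMap.range (α i)) = l i + m i := by
    rw [← hprod, ← LinearMap.exact_iff.1 (h₁ i)]
    exact LinearMap.finrank_range_add_finrank_ker (β i)
  have hδ (i : ℕ) : Module.finrank ℚ (LinearMap.ker (α i)) +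
      Module.finrank ℚ (LinearMap.range (β (i + 1))) = bettiNumber X (i + 1) := by
    rw [LinearMap.exact_iff.1 (h₃ i), ← LinearMap.exact_iff.1 (h₂ i)]
    exact LinearMap.finrank_range_add_finrank_ker (δ i)
  have hβ₀ : Module.finrank ℚ (LinearMap.range (β 0)) = bettiNumber X 0 := by
    rw [LinearMap.range_eq_top.2 h₄, finrank_top]
    rfl
  refine ⟨bettiNumber X, fun i => Module.finrank ℚ (LinearMap.range (α i)),
    fun i => ⟨hN i, rfl⟩, fun i => ?_, fun i => ?_, ?_, fun i => ?_⟩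
  · have := hα i; lia
  · have := hβ i; lia
  · have := hβ 0; lia
  · have := hα i; have := hβ (i + 1); have := hδ i; lia

lemma HasBetti.congr {b c : ℕ → ℕ} (h : HasBetti X b) (hbc : ∀ i, b i = c i) : HasBetti X c :=
  fun i => ⟨(h i).1, (h i).2.trans (hbc i)⟩

end Betti

/-! ### The homology of a punctured vector space -/

section Punctured

open scoped ContinuousMap

/-- A subset of `S`, as a subspace of `S` or of the ambient space. -/
def homeomorphPreimageVal {Z : Type} [TopologicalSpace Z] {S T : Set Z} (h : T ⊆ S) :
    ↥((↑) ⁻¹' T : Set S) ≃ₜ T where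
  toFun x := ⟨x.1.1, x.2⟩
  invFun x := ⟨⟨x.1, h x.2⟩, x.2⟩
  left_inv _ := rfl
  right_inv _ := rfl
  continuous_toFun := by fun_prop
  continuous_invFun := by fun_prop

variable {E : Type} [NormedAddCommGroup E]

/-- The complement of a half-line in `E × ℝ`: of the upward one for `ε = 1`, and of the downward one
for `ε = -1`. -/
def slit (E : Type) [NormedAddCommGroup E] (ε : ℝ) : Set (E × ℝ) := {p | p.1 = 0 → ε * p.2 < 0}

lemma isOpen_slit (ε : ℝ) : IsOpen (slit E ε) := by
  have : slit E ε = {p : E × ℝ | p.1 = 0}ᶜ ∪ {p : E × ℝ | ε * p.2 < 0} := by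
    ext p
    simp only [slit, Set.mem_ofPred_eq, Set.mem_union, Set.mem_compl_iff]
    tauto
  rw [this]
  exact (isClosed_eq continuous_fst continuous_const).isOpen_compl.union
    (isOpen_lt (by fun_prop) continuous_const)

variable [NormedSpace ℝ E]

lemma contractibleSpace_slit {ε : ℝ} (hε : ε * ε = 1) : ContractibleSpace (slit E ε) := by
  have h : StarConvex ℝ ((0, -ε) : E × ℝ) (slit E ε) := by
    intro p hp a b ha hb hab h0
    simp only [Prod.fst_add, Prod.smul_fst, smul_zero, zero_add, smul_eq_zero, Prod.snd_add,
      Prod.smul_snd, smul_eq_mul] at h0 ⊢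
    have e : ε * (a * -ε + b * p.2) = -a + b * (ε * p.2) := by linear_combination -a * hε
    rw [e]
    rcases h0 with rfl | h0
    · rw [add_zero] at hab; rw [hab]; norm_num
    · have := hp h0
      rcases hb.eq_or_lt with rfl | hb
      · rw [add_zero] at hab; rw [hab]; norm_num
      · nlinarith
  exact h.contractibleSpace ⟨(0, -ε), fun _ => by simp [hε]⟩

/-- The cylinder over the punctured space `E` is homotopy equivalent to it. -/
def puncturedCylinder (E : Type) [NormedAddCommGroup E] [NormedSpace ℝ E] :
    {p : E × ℝ // p.1 ≠ 0} ≃ₕ {x : E // x ≠ 0} where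
  toFun := ⟨fun p => ⟨p.1.1, p.2⟩, by fun_prop⟩
  invFun := ⟨fun x => ⟨(x.1, 0), x.2⟩, by fun_prop⟩
  left_inv := ⟨{
    toFun := fun q => ⟨(q.2.1.1, (q.1 : ℝ) * q.2.1.2), q.2.2⟩
    continuous_toFun := by fun_prop
    map_zero_left := fun p => by simp
    map_one_left := fun p => by simp }⟩
  right_inv := ⟨ContinuousMap.Homotopy.refl _⟩

/-- The inductive step: the punctured space `E × ℝ` is covered by two slit spaces, which are
contractible, and whose intersection is a cylinder over the punctured space `E`. -/
lemma HasBetti.exists_of_punctured {k : ℕ → ℕ} (hk : HasBetti {x : E // x ≠ 0} k) :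
    ∃ n r : ℕ → ℕ, HasBetti {p : E × ℝ // p ≠ 0} n ∧ (∀ i, r i ≤ k i) ∧
      (∀ i, r i ≤ if i = 0 then 2 else 0) ∧ n 0 + r 0 = 2 ∧
      ∀ i, n (i + 1) + r (i + 1) + r i = k i := by
  have hsub (ε : ℝ) : slit E ε ⊆ {p : E × ℝ | p ≠ 0} := by
    rintro p hp rfl
    simpa using hp rfl
  have hc (ε : ℝ) (hε : ε * ε = 1) :
      ContractibleSpace ↥((↑) ⁻¹' (slit E ε) : Set {p : E × ℝ // p ≠ 0}) :=
    have := contractibleSpace_slit (E := E) hε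
    (homeomorphPreimageVal (hsub ε)).contractibleSpace
  have _ := hc 1 (by norm_num)
  have _ := hc (-1) (by norm_num)
  have hU := (isOpen_slit (E := E) 1).preimage (continuous_subtype_val (p := fun p => p ≠ 0))
  have hV := (isOpen_slit (E := E) (-1)).preimage (continuous_subtype_val (p := fun p => p ≠ 0))
  have hUV : ((↑) ⁻¹' (slit E 1) : Set {p : E × ℝ // p ≠ 0}) ∪ (↑) ⁻¹' (slit E (-1)) =
      Set.univ := by
    refine Set.eq_univ_of_forall fun p => ?_
    by_contra h
    simp only [slit, Set.mem_union, Set.mem_preimage, Set.mem_ofPred_eq] at h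
    push Not at h
    exact p.2 (Prod.ext h.1.1 (by linarith [h.1.2, h.2.2] : p.1.2 = 0))
  have hinter : slit E 1 ∩ slit E (-1) = {p : E × ℝ | p.1 ≠ 0} := by
    ext p
    simp only [slit, Set.mem_inter_iff, Set.mem_ofPred_eq]
    constructor
    · rintro ⟨h, h'⟩ h0
      linarith [h h0, h' h0]
    · exact fun h => ⟨fun h0 => absurd h0 h, fun h0 => absurd h0 h⟩
  have hK : HasBetti
      ↥(((↑) ⁻¹' (slit E 1) : Set {p : E × ℝ // p ≠ 0}) ∩ (↑) ⁻¹' (slit E (-1))) k := by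
    rw [← Set.preimage_inter, hinter]
    refine (hk.of_homotopyEquiv (puncturedCylinder E)).of_homeomorph
      (homeomorphPreimageVal (T := {p : E × ℝ | p.1 ≠ 0}) ?_)
    rintro p hp rfl
    exact hp rfl
  obtain ⟨n, r, h₁, h₂, h₃, h₄, h₅⟩ := HasBetti.exists_of_union hU hV hUV hK
    hasBetti_of_contractibleSpace hasBetti_of_contractibleSpace
  refine ⟨n, r, h₁, h₂, fun i => (h₃ i).trans ?_, by simpa using h₄, fun i => by simpa using h₅ i⟩
  split_ifs <;> simp

/-- A punctured real vector space of dimension `d + 1` has the Betti numbers of the `d`-sphere. -/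
theorem hasBetti_punctured (d : ℕ) (E : Type) [NormedAddCommGroup E] [NormedSpace ℝ E]
    (hE : Module.finrank ℝ E = d + 1) :
    HasBetti {x : E // x ≠ 0} fun i => (if i = 0 then 1 else 0) + if i = d then 1 else 0 := by
  have : FiniteDimensional ℝ E := Module.finite_of_finrank_pos (by lia)
  have e : E ≃L[ℝ] (Fin d → ℝ) × ℝ := ContinuousLinearEquiv.ofFinrankEq (by simp [hE])
  let e' : {x : E // x ≠ 0} ≃ₜ {p : (Fin d → ℝ) × ℝ // p ≠ 0} :=
    e.toHomeomorph.subtype fun x => by simp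
  induction d generalizing E with
  | zero =>
    have : IsEmpty {x : Fin 0 → ℝ // x ≠ 0} := ⟨fun x => x.2 (Subsingleton.elim _ _)⟩
    obtain ⟨n, r, h₁, h₂, h₃, h₄, h₅⟩ := HasBetti.exists_of_punctured
      (hasBetti_of_isEmpty (X := {x : Fin 0 → ℝ // x ≠ 0}))
    refine (h₁.congr fun i => ?_).of_homeomorph e'
    have h0 := h₂ 0
    cases i with
    | zero => simp; lia
    | succ i => have := h₅ i; simp; lia
  | succ d ih =>
    obtain ⟨n, r, h₁, h₂, h₃, h₄, h₅⟩ := HasBetti.exists_of_punctured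
      (ih (Fin (d + 1) → ℝ) (by simp) inferInstance
        (ContinuousLinearEquiv.ofFinrankEq (by simp)))
    have : PathConnectedSpace {x : E // x ≠ 0} := isPathConnected_iff_pathConnectedSpace.1
      (isPathConnected_compl_singleton_of_one_lt_rank
        (Module.lt_rank_of_lt_finrank (by rw [hE]; simp)) (0 : E))
    have h0 : n 0 = 1 := ((h₁.of_homeomorph e') 0).2.symm.trans
      bettiNumber_zero_of_pathConnectedSpace
    refine (h₁.congr fun i => ?_).of_homeomorph e'
    cases i with
    | zero => simp [h0]
    | succ i =>
      have h5 := h₅ i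
      have h3 := h₃ (i + 1)
      have h3' := h₃ i
      cases i <;> simp at h5 h3 h3' ⊢ <;> lia

end Punctured

/-! ### The homology of complex projective space -/

namespace Projectivization

open scoped ContinuousMap

variable {n : ℕ}

/-- The projection from the punctured vector space to the projective space. -/
noncomputable def proj (n : ℕ) (v : {v : Fin n → ℂ // v ≠ 0}) : Projectivization ℂ (Fin n → ℂ) :=
  Projectivization.mk ℂ v.1 v.2

lemma isOpenQuotientMap_proj (n : ℕ) : IsOpenQuotientMap (proj n) where
  surjective x := ⟨⟨x.rep, x.rep_nonzero⟩, x.mk_rep⟩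
  continuous := continuous_quotient_mk'
  isOpenMap U hU := by
    change IsOpen (proj n ⁻¹' (proj n '' U))
    have h : proj n ⁻¹' (proj n '' U) = ⋃ a : ℂˣ,
        (fun v : {v : Fin n → ℂ // v ≠ 0} =>
          (⟨a • v.1, (smul_ne_zero_iff_ne a).2 v.2⟩ : {v : Fin n → ℂ // v ≠ 0})) ⁻¹' U := by
      ext v
      simp only [Set.mem_preimage, Set.mem_image, Set.mem_iUnion]
      constructor
      · rintro ⟨w, hw, hwv⟩
        obtain ⟨a, ha⟩ := (mk_eq_mk_iff ℂ _ _ w.2 v.2).1 hwv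
        refine ⟨a, ?_⟩
        convert hw
      · rintro ⟨a, ha⟩
        exact ⟨_, ha, (mk_eq_mk_iff ℂ _ _ _ v.2).2 ⟨a, rfl⟩⟩
    rw [h]
    refine isOpen_iUnion fun a => hU.preimage ?_
    fun_prop

lemma exists_smul_eq_rep_mk {v : Fin n → ℂ} (hv : v ≠ 0) : ∃ a : ℂˣ, a • v = (mk ℂ v hv).rep :=
  (mk_eq_mk_iff ℂ _ _ (rep_nonzero _) hv).1 (mk_rep _)

/-- The affine chart where the first homogeneous coordinate does not vanish. -/
def chart (n : ℕ) : Set (Projectivization ℂ (Fin (n + 1) → ℂ)) := {x | x.rep 0 ≠ 0}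

/-- The complement of the origin of the affine chart. -/
def chartCompl (n : ℕ) : Set (Projectivization ℂ (Fin (n + 1) → ℂ)) := {x | Fin.tail x.rep ≠ 0}

lemma mk_mem_chart {v : Fin (n + 1) → ℂ} (hv : v ≠ 0) : mk ℂ v hv ∈ chart n ↔ v 0 ≠ 0 := by
  obtain ⟨a, ha⟩ := exists_smul_eq_rep_mk hv
  change (mk ℂ v hv).rep 0 ≠ 0 ↔ _
  rw [← ha, Pi.smul_apply, smul_ne_zero_iff_ne]

lemma tail_smul (a : ℂˣ) (v : Fin (n + 1) → ℂ) : Fin.tail (a • v) = a • Fin.tail v := rfl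

lemma mk_mem_chartCompl {v : Fin (n + 1) → ℂ} (hv : v ≠ 0) :
    mk ℂ v hv ∈ chartCompl n ↔ Fin.tail v ≠ 0 := by
  obtain ⟨a, ha⟩ := exists_smul_eq_rep_mk hv
  change Fin.tail (mk ℂ v hv).rep ≠ 0 ↔ _
  rw [← ha, tail_smul, smul_ne_zero_iff_ne]

lemma continuous_tail : Continuous (Fin.tail : (Fin (n + 1) → ℂ) → Fin n → ℂ) :=
  continuous_pi fun i => continuous_apply i.succ

lemma continuous_cons : Continuous fun p : ℂ × (Fin n → ℂ) =>
    (Fin.cons p.1 p.2 : Fin (n + 1) → ℂ) :=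
  continuous_pi fun i => by
    refine Fin.cases ?_ (fun i => ?_) i
    · simpa using continuous_fst
    · exact (continuous_apply i).comp continuous_snd

lemma isOpen_chart (n : ℕ) : IsOpen (chart n) := by
  rw [← (isOpenQuotientMap_proj (n + 1)).isQuotientMap.isOpen_preimage]
  have : proj (n + 1) ⁻¹' chart n = {v | v.1 0 ≠ 0} := Set.ext fun v => mk_mem_chart v.2
  rw [this]
  exact isOpen_ne_fun ((continuous_apply 0).comp continuous_subtype_val) continuous_const

lemma isOpen_chartCompl (n : ℕ) : IsOpen (chartCompl n) := by
  rw [← (isOpenQuotientMap_proj (n + 1)).isQuotientMap.isOpen_preimage]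
  have : proj (n + 1) ⁻¹' chartCompl n = {v | Fin.tail v.1 ≠ 0} :=
    Set.ext fun v => mk_mem_chartCompl v.2
  rw [this]
  exact isOpen_ne_fun (continuous_tail.comp continuous_subtype_val) continuous_const

lemma chart_union_chartCompl (n : ℕ) : chart n ∪ chartCompl n = Set.univ := by
  refine Set.eq_univ_of_forall fun x => ?_
  by_contra h
  simp only [chart, chartCompl, Set.mem_union, Set.mem_ofPred_eq] at h
  push Not at h
  refine x.rep_nonzero (funext fun i => ?_)
  refine Fin.cases h.1 (fun i => ?_) i
  exact congr_fun h.2 i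

lemma cons_ne_zero_of_right {v : Fin n → ℂ} (hv : v ≠ 0) (a : ℂ) :
    (Fin.cons a v : Fin (n + 1) → ℂ) ≠ 0 := fun h =>
  hv (funext fun i => by simpa using congr_fun h i.succ)

lemma cons_one_ne_zero (v : Fin n → ℂ) : (Fin.cons 1 v : Fin (n + 1) → ℂ) ≠ 0 := fun h => by
  simpa using congr_fun h 0

/-- The inhomogeneous coordinates on the affine chart. -/
noncomputable def chartHomeomorph (n : ℕ) : chart n ≃ₜ (Fin n → ℂ) where
  toFun x i := x.1.rep i.succ / x.1.rep 0
  invFun y := ⟨mk ℂ (Fin.cons 1 y) (cons_one_ne_zero y), (mk_mem_chart _).2 (by simp)⟩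
  left_inv x := by
    apply Subtype.ext
    conv_rhs => rw [← mk_rep x.1]
    refine (mk_eq_mk_iff' ℂ _ _ _ _).2 ⟨(x.1.rep 0)⁻¹, funext fun i => ?_⟩
    have hx : x.1.rep 0 ≠ 0 := x.2
    refine Fin.cases ?_ (fun i => ?_) i
    · simp [hx]
    · simp [div_eq_inv_mul]
  right_inv y := by
    obtain ⟨a, ha⟩ := exists_smul_eq_rep_mk (cons_one_ne_zero y)
    funext i
    simp [← ha, Units.smul_def]
  continuous_toFun := by
    rw [((isOpenQuotientMap_proj (n + 1)).restrictPreimage (chart n)).isQuotientMap.continuous_iff]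
    refine continuous_pi fun i => ?_
    have h (v : proj (n + 1) ⁻¹' chart n) : (proj (n + 1) v.1).rep i.succ /
        (proj (n + 1) v.1).rep 0 = v.1.1 i.succ / v.1.1 0 := by
      obtain ⟨a, ha⟩ := exists_smul_eq_rep_mk v.1.2
      rw [proj, ← ha]
      simp [Units.smul_def, mul_div_mul_left]
    refine Continuous.congr (f := fun v : proj (n + 1) ⁻¹' chart n => v.1.1 i.succ / v.1.1 0) ?_
      fun v => (h v).symm
    have hval : Continuous fun v : proj (n + 1) ⁻¹' chart n => v.1.1 :=
      continuous_subtype_val.comp continuous_subtype_val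
    exact ((continuous_apply _).comp hval).div ((continuous_apply _).comp hval)
      fun v => (mk_mem_chart v.1.2).1 v.2
  continuous_invFun := by
    refine Continuous.subtype_mk ((isOpenQuotientMap_proj (n + 1)).continuous.comp
      (f := fun y : Fin n → ℂ => ⟨Fin.cons 1 y, cons_one_ne_zero y⟩) ?_) _
    exact Continuous.subtype_mk (continuous_cons.comp (Continuous.prodMk_right 1)) _

lemma tail_cons (a : ℂ) (v : Fin n → ℂ) : Fin.tail (Fin.cons a v : Fin (n + 1) → ℂ) = v :=
  Fin.tail_cons _ _

/-- The intersection of the affine chart with the complement of its origin is a punctured vector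
space. -/
noncomputable def chartInterHomeomorph (n : ℕ) :
    ↥(chart n ∩ chartCompl n) ≃ₜ {y : Fin n → ℂ // y ≠ 0} :=
  (homeomorphPreimageVal Set.inter_subset_left).symm.trans
    ((chartHomeomorph n).subtype fun x => by
      have hx : x.1.rep 0 ≠ 0 := x.2
      change x.1.rep 0 ≠ 0 ∧ Fin.tail x.1.rep ≠ 0 ↔ _
      simp only [hx, ne_eq, not_false_eq_true, true_and, not_iff_not, funext_iff]
      exact forall_congr' fun i => (div_eq_zero_iff.trans (or_iff_left hx)).symm)

/-- The linear projection from the origin of the affine chart to the hyperplane at infinity. -/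
noncomputable def toHyperplane (n : ℕ) :
    C(chartCompl n, Projectivization ℂ (Fin n → ℂ)) where
  toFun x := mk ℂ (Fin.tail x.1.rep) x.2
  continuous_toFun := by
    rw [((isOpenQuotientMap_proj (n + 1)).restrictPreimage
      (chartCompl n)).isQuotientMap.continuous_iff]
    refine Continuous.congr (f := fun v : proj (n + 1) ⁻¹' chartCompl n =>
      proj n ⟨Fin.tail v.1.1, (mk_mem_chartCompl v.1.2).1 v.2⟩) ?_ fun v => ?_
    · exact (isOpenQuotientMap_proj n).continuous.comp (Continuous.subtype_mk
        (continuous_tail.comp (continuous_subtype_val.comp continuous_subtype_val)) _)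
    · obtain ⟨a, ha⟩ := exists_smul_eq_rep_mk v.1.2
      refine ((mk_eq_mk_iff ℂ _ _ _ _).2 ⟨a, ?_⟩).symm
      exact congr_arg Fin.tail ha

/-- The inclusion of the hyperplane at infinity of the affine chart. -/
noncomputable def ofHyperplane (n : ℕ) :
    C(Projectivization ℂ (Fin n → ℂ), chartCompl n) where
  toFun x := ⟨mk ℂ (Fin.cons 0 x.rep) (cons_ne_zero_of_right x.rep_nonzero 0),
    (mk_mem_chartCompl _).2 (by rw [tail_cons]; exact x.rep_nonzero)⟩
  continuous_toFun := by
    refine Continuous.subtype_mk ?_ _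
    rw [(isOpenQuotientMap_proj n).isQuotientMap.continuous_iff]
    refine Continuous.congr (f := fun v => proj (n + 1)
      ⟨Fin.cons 0 v.1, cons_ne_zero_of_right v.2 0⟩) ?_ fun v => ?_
    · exact (isOpenQuotientMap_proj (n + 1)).continuous.comp (Continuous.subtype_mk
        (continuous_cons.comp ((Continuous.prodMk_right 0).comp continuous_subtype_val)) _)
    · obtain ⟨a, ha⟩ := exists_smul_eq_rep_mk v.2
      refine ((mk_eq_mk_iff ℂ _ _ _ _).2 ⟨a, funext fun i => ?_⟩).symm
      refine Fin.cases ?_ (fun i => ?_) i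
      · simp
      · exact congr_fun ha i

/-- The deformation which multiplies the first homogeneous coordinate by `t`, for `t` from `0`
to `1`. -/
noncomputable def hyperplaneHomotopy (n : ℕ) :
    ((ofHyperplane n).comp (toHyperplane n)).Homotopy (ContinuousMap.id (chartCompl n)) where
  toFun p := ⟨mk ℂ (Fin.cons ((p.1 : ℝ) * p.2.1.rep 0) (Fin.tail p.2.1.rep))
      (cons_ne_zero_of_right p.2.2 _), (mk_mem_chartCompl _).2 (by rw [tail_cons]; exact p.2.2)⟩
  continuous_toFun := by
    refine Continuous.subtype_mk ?_ _
    rw [(IsOpenQuotientMap.id.prodMap ((isOpenQuotientMap_proj (n + 1)).restrictPreimage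
      (chartCompl n))).isQuotientMap.continuous_iff]
    refine Continuous.congr (f := fun p : unitInterval × (proj (n + 1) ⁻¹' chartCompl n) =>
      proj (n + 1) ⟨Fin.cons ((p.1 : ℝ) * p.2.1.1 0) (Fin.tail p.2.1.1),
        cons_ne_zero_of_right ((mk_mem_chartCompl p.2.1.2).1 p.2.2) _⟩) ?_ fun p => ?_
    · have hval : Continuous fun p : unitInterval × (proj (n + 1) ⁻¹' chartCompl n) => p.2.1.1 :=
        continuous_subtype_val.comp (continuous_subtype_val.comp continuous_snd)
      refine (isOpenQuotientMap_proj (n + 1)).continuous.comp (Continuous.subtype_mk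
        (continuous_cons.comp (Continuous.prodMk ?_ ?_)) _)
      · exact (Complex.continuous_ofReal.comp (continuous_subtype_val.comp continuous_fst)).mul
          ((continuous_apply 0).comp hval)
      · exact continuous_tail.comp hval
    · obtain ⟨a, ha⟩ := exists_smul_eq_rep_mk p.2.1.2
      refine ((mk_eq_mk_iff ℂ _ _ _ _).2 ⟨a, ?_⟩).symm
      change _ = (Fin.cons _ (Fin.tail (mk ℂ p.2.1.1 p.2.1.2).rep) : Fin (n + 1) → ℂ)
      funext i
      refine Fin.cases ?_ (fun i => ?_) i
      · change a • (((p.1 : ℝ) : ℂ) * p.2.1.1 0) = ((p.1 : ℝ) : ℂ) * (mk ℂ p.2.1.1 p.2.1.2).rep 0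
        rw [← ha, Pi.smul_apply, mul_smul_comm]
      · exact congr_fun ha i.succ
  map_zero_left x := by
    apply Subtype.ext
    obtain ⟨a, ha⟩ := exists_smul_eq_rep_mk (v := Fin.tail x.1.rep) x.2
    refine ((mk_eq_mk_iff ℂ _ _ _ _).2 ⟨a, funext fun i => ?_⟩).symm
    refine Fin.cases ?_ (fun i => ?_) i
    · simp
    · exact congr_fun ha i
  map_one_left x := by
    apply Subtype.ext
    conv_rhs => rw [ContinuousMap.id_apply, ← mk_rep x.1]
    refine (mk_eq_mk_iff ℂ _ _ _ _).2 ⟨1, ?_⟩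
    simp

/-- The complement of the origin of the affine chart retracts onto the hyperplane at infinity. -/
noncomputable def hyperplaneHomotopyEquiv (n : ℕ) :
    chartCompl n ≃ₕ Projectivization ℂ (Fin n → ℂ) where
  toFun := toHyperplane n
  invFun := ofHyperplane n
  left_inv := ⟨hyperplaneHomotopy n⟩
  right_inv := by
    have h : (toHyperplane n).comp (ofHyperplane n) = ContinuousMap.id _ := by
      ext x : 1
      obtain ⟨a, ha⟩ := exists_smul_eq_rep_mk (cons_ne_zero_of_right x.rep_nonzero 0)
      conv_rhs => rw [ContinuousMap.id_apply, ← mk_rep x]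
      refine (mk_eq_mk_iff ℂ _ _ _ _).2 ⟨a, ?_⟩
      change _ = Fin.tail (mk ℂ _ (cons_ne_zero_of_right x.rep_nonzero 0)).rep
      rw [← ha, tail_smul, tail_cons]
    rw [h]

instance (n : ℕ) : PathConnectedSpace (Projectivization ℂ (Fin (n + 1) → ℂ)) := by
  have hrank : Module.finrank ℝ (Fin (n + 1) → ℂ) = (n + 1) * 2 := by
    simp [Module.finrank_pi_fintype, Complex.finrank_real_complex]
  have : PathConnectedSpace {x : Fin (n + 1) → ℂ // x ≠ 0} :=
    isPathConnected_iff_pathConnectedSpace.1 (isPathConnected_compl_singleton_of_one_lt_rank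
      (Module.lt_rank_of_lt_finrank (by rw [hrank]; lia)) (0 : Fin (n + 1) → ℂ))
  exact (isOpenQuotientMap_proj (n + 1)).surjective.pathConnectedSpace
    (isOpenQuotientMap_proj (n + 1)).continuous

/-- The Betti numbers of the projective space of `ℂ ^ n`. -/
theorem hasBetti (n : ℕ) : HasBetti (Projectivization ℂ (Fin n → ℂ))
    fun i => if Even i ∧ i < 2 * n then 1 else 0 := by
  induction n with
  | zero =>
    have : IsEmpty (Projectivization ℂ (Fin 0 → ℂ)) :=
      ⟨fun x => x.rep_nonzero (Subsingleton.elim _ _)⟩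
    exact hasBetti_of_isEmpty.congr fun i => by simp
  | succ n ih =>
    have : ContractibleSpace (chart n) := (chartHomeomorph n).contractibleSpace
    have hm := ih.of_homotopyEquiv (hyperplaneHomotopyEquiv n)
    obtain ⟨k, hk, hk'⟩ : ∃ k, HasBetti {y : Fin n → ℂ // y ≠ 0} k ∧
        ∀ i, k i = if n = 0 then 0 else
          (if i = 0 then 1 else 0) + if i = 2 * n - 1 then 1 else 0 := by
      cases n with
      | zero =>
        have : IsEmpty {y : Fin 0 → ℂ // y ≠ 0} := ⟨fun y => y.2 (Subsingleton.elim _ _)⟩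
        exact ⟨_, hasBetti_of_isEmpty, fun i => by simp⟩
      | succ n =>
        refine ⟨_, hasBetti_punctured (2 * (n + 1) - 1) (Fin (n + 1) → ℂ) ?_, fun i => by simp⟩
        simp [Module.finrank_pi_fintype, Complex.finrank_real_complex]
        lia
    obtain ⟨b, r, h₁, h₂, h₃, h₄, h₅⟩ := HasBetti.exists_of_union (isOpen_chart n)
      (isOpen_chartCompl n) (chart_union_chartCompl n)
      (hk.of_homeomorph (chartInterHomeomorph n)) hasBetti_of_contractibleSpace hm
    have h0 : b 0 = 1 := (h₁ 0).2.symm.trans bettiNumber_zero_of_pathConnectedSpace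
    -- In positive degrees the homology of the intersection lives in degree `2 * n - 1`, where the
    -- two pieces have none.
    have hr (i : ℕ) : r (i + 1) = 0 := by
      have h2 := h₂ (i + 1)
      have h3 := h₃ (i + 1)
      rw [hk'] at h2
      simp only [Nat.even_iff] at h3
      split_ifs at h2 h3 <;> lia
    refine h₁.congr fun i => ?_
    simp only [Nat.even_iff]
    cases i with
    | zero => simp [h0]
    | succ i =>
      have h5 := h₅ i
      rw [hr, hk'] at h5
      cases i with
      | zero =>
        simp only [Nat.even_iff] at h5 h₄
        split_ifs at h5 h₄ ⊢ <;> lia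
      | succ i =>
        rw [hr] at h5
        simp only [Nat.even_iff] at h5
        split_ifs at h5 ⊢ <;> lia

end Projectivization

/-! ### Quotients of polynomials on lines through the origin -/

namespace MvPolynomial

variable {σ : Type}

lemma IsHomogeneous.eval_smul {p : MvPolynomial σ ℂ} {k : ℕ} (hp : p.IsHomogeneous k) (c : ℂ)
    (x : σ → ℂ) : eval (c • x) p = c ^ k * eval x p := by
  rw [eval_eq, eval_eq, Finset.mul_sum]
  refine Finset.sum_congr rfl fun d hd => ?_
  have h : ∑ i ∈ d.support, d i = k := by
    have := hp (mem_support_iff.1 hd)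
    simpa [Finsupp.weight_apply, Finsupp.sum] using this
  simp only [Pi.smul_apply, smul_eq_mul, mul_pow, Finset.prod_mul_distrib,
    Finset.prod_pow_eq_pow_sum, h]
  ring

/-- The restriction of a polynomial to the line through `x` and the origin. -/
noncomputable def alongLine (x : σ → ℂ) (p : MvPolynomial σ ℂ) : Polynomial ℂ :=
  ∑ j ∈ Finset.range (p.totalDegree + 1),
    Polynomial.monomial j (eval x (homogeneousComponent j p))

lemma eval_alongLine (x : σ → ℂ) (p : MvPolynomial σ ℂ) (c : ℂ) :
    (alongLine x p).eval c = eval (c • x) p := by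
  conv_rhs => rw [← sum_homogeneousComponent p, map_sum]
  simp only [alongLine, Polynomial.eval_finsetSum, Polynomial.eval_monomial]
  refine Finset.sum_congr rfl fun j _ => ?_
  rw [(homogeneousComponent_isHomogeneous j p).eval_smul, mul_comm]

lemma coeff_alongLine (x : σ → ℂ) (p : MvPolynomial σ ℂ) (k : ℕ) :
    (alongLine x p).coeff k = eval x (homogeneousComponent k p) := by
  simp only [alongLine, Polynomial.finsetSum_coeff, Polynomial.coeff_monomial,
    Finset.sum_ite_eq', Finset.mem_range]
  split_ifs with h
  · rfl
  · rw [homogeneousComponent_eq_zero _ _ (by lia), map_zero]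

/-- If `p / q` is constant on the part of a line through the origin where `q` does not vanish, then
the same holds for the homogeneous components of `p` and `q`. -/
lemma eval_homogeneousComponent_eq_mul {p q : MvPolynomial σ ℂ} {x : σ → ℂ} {a : ℂ}
    (h : ∀ c : ℂ, c ≠ 0 → eval (c • x) q ≠ 0 → eval (c • x) p = a * eval (c • x) q)
    {k : ℕ} (hk : eval x (homogeneousComponent k q) ≠ 0) (j : ℕ) :
    eval x (homogeneousComponent j p) = a * eval x (homogeneousComponent j q) := by
  have hQ : alongLine x q ≠ 0 := fun h0 => hk (by rw [← coeff_alongLine, h0, Polynomial.coeff_zero])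
  -- The factor `alongLine x q * X` takes care of the points where `h` gives nothing.
  have hz : (alongLine x p - Polynomial.C a * alongLine x q) *
      (alongLine x q * Polynomial.X) = 0 := by
    refine Polynomial.funext fun c => ?_
    simp only [Polynomial.eval_mul, Polynomial.eval_sub, Polynomial.eval_C, Polynomial.eval_X,
      Polynomial.eval_zero, eval_alongLine]
    by_cases hc : c = 0
    · simp [hc]
    by_cases hq : eval (c • x) q = 0
    · simp [hq]
    rw [h c hc hq, sub_self, zero_mul]
  have he := sub_eq_zero.1 ((mul_eq_zero.1 hz).resolve_right (mul_ne_zero hQ Polynomial.X_ne_zero))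
  rw [← coeff_alongLine, he, Polynomial.coeff_C_mul, coeff_alongLine]

lemma exists_eval_smul_ne_zero {q : MvPolynomial σ ℂ} {x : σ → ℂ} {k : ℕ}
    (hk : eval x (homogeneousComponent k q) ≠ 0) : ∃ c : ℂ, c ≠ 0 ∧ eval (c • x) q ≠ 0 := by
  by_contra! h
  refine hk ?_
  have := eval_homogeneousComponent_eq_mul (p := q) (q := q) (x := x) (a := 0)
    (fun c hc hq => absurd (h c hc) hq) hk k
  simpa using this

end MvPolynomial

/-! ### Representations of the two-node quiver -/

namespace TwoNode

open QuiverRep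

variable {l : ℕ} {ζ : TwoNode l → ℝ}

lemma sum_univ {M : Type*} [AddCommMonoid M] (f : TwoNode l → M) : ∑ v, f v = f n1 + f n2 :=
  Finset.sum_pair (by simp)

/-- The `i`-th arrow. -/
def arrow (i : Fin l) : Quiver.Total (TwoNode l) := ⟨n2, n1, i⟩

/-- The number of an arrow. -/
def arrowIndex : Quiver.Total (TwoNode l) → Fin l
  | ⟨n2, n1, i⟩ => i
  | ⟨n1, n1, i⟩ => i.elim
  | ⟨n1, n2, i⟩ => i.elim
  | ⟨n2, n2, i⟩ => i.elim

lemma arrow_arrowIndex : ∀ a : Quiver.Total (TwoNode l), arrow (arrowIndex a) = a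
  | ⟨n2, n1, _⟩ => rfl
  | ⟨n1, n1, i⟩ => i.elim
  | ⟨n1, n2, i⟩ => i.elim
  | ⟨n2, n2, i⟩ => i.elim

/-- A representation with dimension vector `(1, 1)` as a vector: each arrow acts by a scalar. -/
def toVec (f : QuiverRep (TwoNode l) (dim l)) : Fin l → ℂ := fun i => f (arrow i) 0 0

/-- The representation with given scalars. -/
def ofVec (v : Fin l → ℂ) : QuiverRep (TwoNode l) (dim l) := fun a => fun _ _ => v (arrowIndex a)

@[simp] lemma toVec_ofVec (v : Fin l → ℂ) : toVec (ofVec v) = v := rfl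

lemma apply_eq_toVec (f : QuiverRep (TwoNode l) (dim l)) (a : Quiver.Total (TwoNode l))
    (i j : Fin 1) : f a i j = toVec f (arrowIndex a) := by
  rw [toVec, arrow_arrowIndex, Subsingleton.elim i 0, Subsingleton.elim j 0]

@[simp] lemma ofVec_toVec (f : QuiverRep (TwoNode l) (dim l)) : ofVec (toVec f) = f := by
  funext a
  ext i j
  exact (apply_eq_toVec f a i j).symm

lemma continuous_toVec : Continuous (toVec (l := l)) :=
  continuous_pi fun i => (continuous_apply_apply 0 0).comp (continuous_apply (arrow i))

lemma continuous_ofVec : Continuous (ofVec (l := l)) :=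
  continuous_pi fun a => continuous_matrix fun _ _ => continuous_apply (arrowIndex a)

lemma slope_dim (h : ζ n1 + ζ n2 = 0) : QuiverRep.slope ζ (dim l) = 0 := by
  simp [QuiverRep.slope, sum_univ, h]

lemma eq_bot_or_eq_top (W : Submodule ℂ (Fin 1 → ℂ)) : W = ⊥ ∨ W = ⊤ :=
  have := isSimpleModule_iff_finrank_eq_one.2 (Module.finrank_fin_fun ℂ (n := 1))
  IsSimpleOrder.eq_bot_or_eq_top W

/-- Node 1 has only incoming arrows, so it supports a subrepresentation of dimension `(1, 0)`. -/
lemma isSubrep_head (f : QuiverRep (TwoNode l) (dim l)) :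
    f.IsSubrep fun v => if v = n1 then ⊤ else ⊥ := by
  rintro ⟨_ | _, _ | _, a⟩
  · exact a.elim
  · exact a.elim
  · simp
  · exact a.elim

lemma neg_of_isStable (h : ζ n1 + ζ n2 = 0) {f : QuiverRep (TwoNode l) (dim l)}
    (hf : f.IsStable ζ) : ζ n1 < 0 := by
  have := hf _ (isSubrep_head f) ⟨n1, by simp⟩ ⟨n2, by simp⟩
  rw [slope_dim h] at this
  simpa [QuiverRep.slope, sum_univ] using this

lemma isStable_iff (h : ζ n1 + ζ n2 = 0) (h₁ : ζ n1 < 0) (f : QuiverRep (TwoNode l) (dim l)) :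
    f.IsStable ζ ↔ toVec f ≠ 0 := by
  constructor
  · intro hf h0
    have hW : f.IsSubrep fun v => if v = n2 then ⊤ else ⊥ := by
      rintro ⟨_ | _, _ | _, a⟩
      · exact a.elim
      · exact a.elim
      · have hz : f ⟨n2, n1, a⟩ = 0 := by
          ext i j
          exact (apply_eq_toVec f ⟨n2, n1, a⟩ i j).trans (congr_fun h0 _)
        simp [hz]
      · exact a.elim
    have := hf _ hW ⟨n2, by simp⟩ ⟨n1, by simp⟩
    rw [slope_dim h] at this
    simp [QuiverRep.slope, sum_univ] at this
    linarith
  · intro h0 W hW hbot htop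
    rw [slope_dim h]
    obtain ⟨i, hi⟩ := Function.ne_iff.1 h0
    have hWi := hW (arrow i)
    have h2 : W n2 = ⊥ := by
      refine (eq_bot_or_eq_top (W n2)).resolve_right fun h2 => ?_
      have h1 : W n1 = ⊤ := by
        refine (eq_bot_or_eq_top (W n1)).resolve_left fun h1 => hi ?_
        have hmem : (f (arrow i)).mulVecLin 1 ∈ W n1 :=
          hWi ⟨1, by change _ ∈ W n2; rw [h2]; trivial, rfl⟩
        rw [h1, Submodule.mem_bot] at hmem
        have h00 : f (arrow i) 0 0 = 0 := by
          simpa [Matrix.mulVec, dotProduct] using congr_fun hmem (0 : Fin 1)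
        exact h00
      obtain ⟨_ | _, hv⟩ := htop
      exacts [hv h1, hv h2]
    have h1 : W n1 = ⊤ := by
      refine (eq_bot_or_eq_top (W n1)).resolve_left fun h1 => ?_
      obtain ⟨_ | _, hv⟩ := hbot
      exacts [hv h1, hv h2]
    have d1 : Module.finrank ℂ (W n1) = 1 :=
      (congr_arg (fun S : Submodule ℂ (Fin 1 → ℂ) => Module.finrank ℂ S) h1).trans (by simp)
    have d2 : Module.finrank ℂ (W n2) = 0 :=
      (congr_arg (fun S : Submodule ℂ (Fin 1 → ℂ) => Module.finrank ℂ S) h2).trans (by simp)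
    simpa [QuiverRep.slope, sum_univ, d1, d2] using h₁

lemma toVec_smul (g : Gauge (TwoNode l) (dim l)) (f : QuiverRep (TwoNode l) (dim l)) :
    toVec (g • f) = ((g n1).val 0 0 * ((g n2)⁻¹).val 0 0) • toVec f := by
  funext i
  change ((g n1).val * f (arrow i) * ((g n2)⁻¹).val) 0 0 = _
  simp only [Matrix.mul_apply, Finset.univ_unique, Finset.sum_singleton]
  simp only [Pi.smul_apply, smul_eq_mul, toVec]
  change (g n1).val 0 0 * f (arrow i) 0 0 * ((g n2)⁻¹).val 0 0 = _
  ring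

lemma exists_gauge_smul_eq (a : ℂˣ) (f : QuiverRep (TwoNode l) (dim l)) :
    ∃ g : Gauge (TwoNode l) (dim l), toVec (g • f) = a • toVec f := by
  refine ⟨fun v => if v = n1 then Matrix.GeneralLinearGroup.scalar (Fin 1) a else 1, ?_⟩
  rw [toVec_smul]
  simp [Units.smul_def]

lemma moduli_mk_eq_mk_iff (h : ζ n1 + ζ n2 = 0) (h₁ : ζ n1 < 0) (f f' : Stable (dim l) ζ) :
    Moduli.mk f = Moduli.mk f' ↔
      Projectivization.mk ℂ (toVec f.1) ((isStable_iff h h₁ f.1).1 f.2) =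
        Projectivization.mk ℂ (toVec f'.1) ((isStable_iff h h₁ f'.1).1 f'.2) := by
  refine Quotient.eq.trans ?_
  constructor
  · rintro ⟨g, hg⟩
    refine (Projectivization.mk_eq_mk_iff' ℂ _ _ _ _).2
      ⟨(g n1).val 0 0 * ((g n2)⁻¹).val 0 0, ?_⟩
    rw [← toVec_smul]
    exact congr_arg toVec hg
  · intro hm
    obtain ⟨a, ha⟩ := (Projectivization.mk_eq_mk_iff ℂ _ _ _ _).1 hm
    obtain ⟨g, hg⟩ := exists_gauge_smul_eq a f'.1
    refine ⟨g, ?_⟩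
    change g • f'.1 = f.1
    rw [← ofVec_toVec (g • f'.1), hg, ha, ofVec_toVec]

/-- The moduli space is the projective space of the space of representations. -/
noncomputable def moduliHomeomorph (h : ζ n1 + ζ n2 = 0) (h₁ : ζ n1 < 0) :
    TwoNode.Moduli l ζ ≃ₜ Projectivization ℂ (Fin l → ℂ) where
  toFun := Quotient.lift (s := stableSetoid (dim l) ζ)
    (fun f => Projectivization.mk ℂ (toVec f.1) ((isStable_iff h h₁ f.1).1 f.2))
    fun f f' hff' => (moduli_mk_eq_mk_iff h h₁ f f').1 (Quotient.sound hff')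
  invFun x := Moduli.mk ⟨ofVec x.rep, (isStable_iff h h₁ _).2 x.rep_nonzero⟩
  left_inv x := by
    obtain ⟨f, rfl⟩ := Quotient.exists_rep x
    exact (moduli_mk_eq_mk_iff h h₁ _ f).2 (Projectivization.mk_rep _)
  right_inv x := Projectivization.mk_rep x
  continuous_toFun := by
    refine Continuous.quotient_lift (s := stableSetoid (dim l) ζ) ?_ _
    exact (Projectivization.isOpenQuotientMap_proj l).continuous.comp
      (f := fun f : Stable (dim l) ζ => ⟨toVec f.1, (isStable_iff h h₁ f.1).1 f.2⟩)
      (Continuous.subtype_mk (continuous_toVec.comp continuous_subtype_val) _)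
  continuous_invFun := by
    rw [(Projectivization.isOpenQuotientMap_proj l).isQuotientMap.continuous_iff]
    refine Continuous.congr (f := fun v => (Moduli.mk
      (⟨ofVec v.1, (isStable_iff h h₁ _).2 v.2⟩ : Stable (dim l) ζ))) ?_ fun v => ?_
    · exact (continuous_quotient_mk' (s := stableSetoid (dim l) ζ)).comp
        (Continuous.subtype_mk (continuous_ofVec.comp continuous_subtype_val) _)
    · exact (moduli_mk_eq_mk_iff h h₁ _ _).2 (Projectivization.mk_rep _).symm

lemma moduliHomeomorph_mk (h : ζ n1 + ζ n2 = 0) (h₁ : ζ n1 < 0) (f : Stable (dim l) ζ) :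
    moduliHomeomorph h h₁ (Moduli.mk f) =
      Projectivization.mk ℂ (toVec f.1) ((isStable_iff h h₁ f.1).1 f.2) := rfl

/-- The coordinate on the space of representations given by an arrow. -/
def coordIndex (i : Fin l) : CoordIndex (TwoNode l) (dim l) := ⟨arrow i, 0, 0⟩

lemma eval_coords_rename (f : QuiverRep (TwoNode l) (dim l)) (p : MvPolynomial (Fin l) ℂ) :
    MvPolynomial.eval (coords f) (MvPolynomial.rename coordIndex p) =
      MvPolynomial.eval (toVec f) p := by
  rw [MvPolynomial.eval_rename]
  rfl

lemma eval_rename_arrowIndex (f : QuiverRep (TwoNode l) (dim l))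
    (p : MvPolynomial (CoordIndex (TwoNode l) (dim l)) ℂ) :
    MvPolynomial.eval (toVec f) (MvPolynomial.rename (fun i => arrowIndex i.1) p) =
      MvPolynomial.eval (coords f) p := by
  rw [MvPolynomial.eval_rename]
  congr 2
  funext i
  exact (apply_eq_toVec f i.1 _ _).symm

/-- The isomorphism of the moduli space with the projective space identifies regular functions. A
fraction on the moduli space may be replaced by a fraction of homogeneous components, since it is
constant along orbits. -/
theorem isRegularOn_iff (h : ζ n1 + ζ n2 = 0) (h₁ : ζ n1 < 0)
    (U : Set (Projectivization ℂ (Fin l → ℂ))) (φ : Projectivization ℂ (Fin l → ℂ) → ℂ) :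
    Projectivization.IsRegularOn U φ ↔
      QuiverRep.Moduli.IsRegularOn (moduliHomeomorph h h₁ ⁻¹' U) (φ ∘ moduliHomeomorph h h₁) := by
  constructor
  · intro hU f hf
    obtain ⟨k, p, q, hp, hq, hq0, hpq⟩ := hU _ hf
    obtain ⟨a, ha⟩ := Projectivization.exists_smul_eq_rep_mk ((isStable_iff h h₁ f.1).1 f.2)
    refine ⟨MvPolynomial.rename coordIndex p, MvPolynomial.rename coordIndex q, ?_, ?_⟩
    · rw [eval_coords_rename]
      intro h0
      apply hq0
      rw [moduliHomeomorph_mk, ← ha, Units.smul_def, hq.eval_smul, h0, mul_zero]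
    · intro f' hf'
      simp only [eval_coords_rename] at hf' ⊢
      exact hpq _ ((isStable_iff h h₁ f'.1).1 f'.2) hf'
  · intro hU x hx
    obtain ⟨p, q, hq0, hpq⟩ := hU ⟨ofVec x.rep, (isStable_iff h h₁ _).2 x.rep_nonzero⟩ (by
      change Projectivization.mk ℂ x.rep x.rep_nonzero ∈ U
      rwa [Projectivization.mk_rep])
    set p' := MvPolynomial.rename (fun i : CoordIndex (TwoNode l) (dim l) => arrowIndex i.1) p
    set q' := MvPolynomial.rename (fun i : CoordIndex (TwoNode l) (dim l) => arrowIndex i.1) q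
    have hpq' (v : Fin l → ℂ) (hv : v ≠ 0) (hqv : MvPolynomial.eval v q' ≠ 0) :
        Projectivization.mk ℂ v hv ∈ U ∧ φ (Projectivization.mk ℂ v hv) =
          MvPolynomial.eval v p' / MvPolynomial.eval v q' := by
      have hp := eval_rename_arrowIndex (ofVec v) p
      have hq := eval_rename_arrowIndex (ofVec v) q
      rw [toVec_ofVec] at hp hq
      rw [hp, hq]
      exact hpq ⟨ofVec v, (isStable_iff h h₁ _).2 hv⟩ (by rwa [← hq])
    have hq0' : MvPolynomial.eval x.rep q' ≠ 0 := by
      have hq := eval_rename_arrowIndex (ofVec x.rep) q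
      rw [toVec_ofVec] at hq
      rwa [hq]
    obtain ⟨k, hk⟩ : ∃ k, MvPolynomial.eval x.rep (MvPolynomial.homogeneousComponent k q') ≠ 0 := by
      by_contra! h0
      apply hq0'
      rw [← MvPolynomial.sum_homogeneousComponent q', map_sum]
      exact Finset.sum_eq_zero fun k _ => h0 k
    refine ⟨k, _, _, MvPolynomial.homogeneousComponent_isHomogeneous k p',
      MvPolynomial.homogeneousComponent_isHomogeneous k q', hk, fun v hv hqv => ?_⟩
    have hmk (c : ℂ) (hc : c ≠ 0) : Projectivization.mk ℂ (c • v) (smul_ne_zero hc hv) =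
        Projectivization.mk ℂ v hv := (Projectivization.mk_eq_mk_iff' ℂ _ _ _ _).2 ⟨c, rfl⟩
    constructor
    · obtain ⟨c, hc, hcq⟩ := MvPolynomial.exists_eval_smul_ne_zero hqv
      rw [← hmk c hc]
      exact (hpq' _ _ hcq).1
    · rw [eq_div_iff hqv]
      refine (MvPolynomial.eval_homogeneousComponent_eq_mul (fun c hc hcq => ?_) hqv k).symm
      rw [← hmk c hc, (hpq' _ (smul_ne_zero hc hv) hcq).2, div_mul_cancel₀ _ hcq]

/-! ### Poincaré polynomial and Donaldson–Thomas invariant -/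

lemma hasBetti_moduli (h : ζ n1 + ζ n2 = 0) (h₁ : ζ n1 < 0) :
    HasBetti (TwoNode.Moduli l ζ) fun i => if Even i ∧ i < 2 * l then 1 else 0 :=
  (Projectivization.hasBetti l).of_homeomorph (moduliHomeomorph h h₁)

lemma isEmpty_moduli (h : ζ n1 + ζ n2 = 0) (h₁ : 0 ≤ ζ n1) : IsEmpty (TwoNode.Moduli l ζ) := by
  refine ⟨fun x => ?_⟩
  obtain ⟨f, rfl⟩ := Quotient.exists_rep x
  exact (neg_of_isStable h f.2).not_ge h₁

end TwoNode

lemma HasBetti.hasPoincarePolynomial {X : Type} [TopologicalSpace X] {b : ℕ → ℕ}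
    (h : HasBetti X b) {P : Polynomial ℤ} (hP : ∀ i, P.coeff i = b i) :
    HasPoincarePolynomial X P := fun i => ⟨(h i).1, by rw [hP, (h i).2]⟩

lemma eulerCharacteristic_of_isEmpty (X : Type) [TopologicalSpace X] [IsEmpty X] :
    eulerCharacteristic X = 0 := by
  have h (i : ℕ) : bettiNumber X i = 0 := (hasBetti_of_isEmpty i).2
  simp [eulerCharacteristic, h]

lemma eulerCharacteristic_of_hasBetti_even {X : Type} [TopologicalSpace X] {l : ℕ}
    (h : HasBetti X fun i => if Even i ∧ i < 2 * l then 1 else 0) : eulerCharacteristic X = l := by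
  have hterm (i : ℕ) : (-1 : ℤ) ^ i * (bettiNumber X i : ℤ) =
      if Even i ∧ i < 2 * l then 1 else 0 := by
    rw [(h i).2]
    beta_reduce
    by_cases hi : Even i ∧ i < 2 * l
    · rw [if_pos hi, if_pos hi, hi.1.neg_one_pow, one_mul, Nat.cast_one]
    · rw [if_neg hi, if_neg hi, Nat.cast_zero, mul_zero]
  have hsum : ∀ m : ℕ, ∑ i ∈ Finset.range (2 * m), (if Even i then (1 : ℤ) else 0) = m := by
    intro m
    induction m with
    | zero => simp
    | succ m ih =>
      rw [Nat.mul_succ, Finset.sum_range_succ, Finset.sum_range_succ, ih]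
      simp
  unfold eulerCharacteristic
  simp only [hterm]
  rw [finsum_eq_sum_of_support_subset (s := Finset.range (2 * l)), ← hsum l]
  · refine Finset.sum_congr rfl fun i hi => ?_
    simp [Finset.mem_range.1 hi]
  · intro i hi
    simp only [Function.mem_support, ne_eq, ite_eq_right_iff, not_forall] at hi
    simpa using hi.1.2

namespace TwoNode

variable {l : ℕ} {ζ : TwoNode l → ℝ}

lemma moduliDim_dim (l : ℕ) : QuiverRep.moduliDim (dim l) = (l : ℤ) - 1 := by
  have h : Fintype.card ((n2 : TwoNode l) ⟶ n1) = l := Fintype.card_fin l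
  have h₁ : Fintype.card ((n1 : TwoNode l) ⟶ n1) = 0 := rfl
  have h₂ : Fintype.card ((n1 : TwoNode l) ⟶ n2) = 0 := rfl
  have h₃ : Fintype.card ((n2 : TwoNode l) ⟶ n2) = 0 := rfl
  have h₄ : Fintype.card (TwoNode l) = 2 := rfl
  simp [QuiverRep.moduliDim, sum_univ, h, h₁, h₂, h₃, h₄]

lemma dtInvariant_of_neg (h : ζ n1 + ζ n2 = 0) (h₁ : ζ n1 < 0) :
    QuiverRep.dtInvariant (dim l) ζ = (-1) ^ (l + 1) * (l : ℤ) := by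
  rw [QuiverRep.dtInvariant, moduliDim_dim,
    eulerCharacteristic_of_hasBetti_even (hasBetti_moduli h h₁)]
  congr 1
  rw [show (l : ℤ) - 1 = ((l + 1 : ℕ) : ℤ) - 2 by push_cast; ring, Int.negOnePow_sub,
    Int.negOnePow_even 2 even_two, mul_one, Int.negOnePow_def, zpow_natCast]
  simp

lemma dtInvariant_of_nonneg (h : ζ n1 + ζ n2 = 0) (h₁ : 0 ≤ ζ n1) :
    QuiverRep.dtInvariant (dim l) ζ = 0 := by
  have := isEmpty_moduli h h₁
  rw [QuiverRep.dtInvariant, eulerCharacteristic_of_isEmpty, mul_zero]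

lemma exists_hasPoincarePolynomial (h : ζ n1 + ζ n2 = 0) (h₁ : ζ n1 < 0) :
    ∃ P : Polynomial ℤ, HasPoincarePolynomial (TwoNode.Moduli l ζ) P ∧
      P * (Polynomial.X ^ 2 - 1) = Polynomial.X ^ (2 * l) - 1 := by
  refine ⟨∑ i ∈ Finset.range l, (Polynomial.X ^ 2) ^ i,
    (hasBetti_moduli h h₁).hasPoincarePolynomial fun i => ?_, ?_⟩
  · simp only [Polynomial.finsetSum_coeff, ← pow_mul, Polynomial.coeff_X_pow]
    split_ifs with hi
    · obtain ⟨⟨j, rfl⟩, hj⟩ := hi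
      rw [Finset.sum_eq_single_of_mem j (Finset.mem_range.2 (by lia))
        fun k _ hk => if_neg (by lia)]
      simp [two_mul]
    · refine Finset.sum_eq_zero fun j hj => if_neg ?_
      rintro rfl
      exact hi ⟨even_two_mul j, by have := Finset.mem_range.1 hj; lia⟩
  · rw [geom_sum_mul, pow_mul]

end TwoNode

/-! ### The `(2, 4)` hypersurface -/

namespace MvPolynomial

lemma coeff_C_mul_X_pow_mul_X_pow (m n i j : ℕ) (a : ℝ) :
    coeff (Finsupp.single (0 : Fin 2) m + Finsupp.single 1 n) (C a * (X 0 ^ i * X 1 ^ j)) =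
      if i = m ∧ j = n then a else 0 := by
  rw [X_pow_eq_monomial, X_pow_eq_monomial, monomial_mul, coeff_C_mul, coeff_monomial]
  have h : Finsupp.single (0 : Fin 2) i + Finsupp.single 1 j =
      Finsupp.single 0 m + Finsupp.single 1 n ↔ i = m ∧ j = n := by
    constructor
    · intro h
      have h₀ := DFunLike.congr_fun h 0
      have h₁ := DFunLike.congr_fun h 1
      simpa using And.intro h₀ h₁
    · rintro ⟨rfl, rfl⟩
      rfl
  simp [h]

end MvPolynomial

open MvPolynomial in
lemma slopeX24_eq (a b : ℤ) (t₁ t₂ : ℝ) :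
    slopeX24 a b t₁ t₂ = 4 * a * t₂ ^ 2 + 2 * b * t₂ ^ 2 + 8 * b * t₁ * t₂ := by
  have h : divisorClass a b * divisorClass t₁ t₂ ^ 2 * divisorClass 2 4 =
      C (2 * a * t₁ ^ 2) * (X 0 ^ 4 * X 1 ^ 0) +
      C (4 * a * t₁ * t₂ + (4 * a + 2 * b) * t₁ ^ 2) * (X 0 ^ 3 * X 1 ^ 1) +
      C (2 * a * t₂ ^ 2 + (4 * a + 2 * b) * (2 * t₁ * t₂) + 4 * b * t₁ ^ 2) *
        (X 0 ^ 2 * X 1 ^ 2) +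
      C ((4 * a + 2 * b) * t₂ ^ 2 + 8 * b * t₁ * t₂) * (X 0 ^ 1 * X 1 ^ 3) +
      C (4 * b * t₂ ^ 2) * (X 0 ^ 0 * X 1 ^ 4) := by
    simp only [divisorClass, map_add, map_mul, map_pow]
    simp only [map_ofNat]
    ring
  rw [slopeX24, integralOverX24, h]
  simp only [coeff_add, coeff_C_mul_X_pow_mul_X_pow]
  norm_num
  ring

lemma zetaX24_n1 (c t₁ t₂ : ℝ) : zetaX24 c t₁ t₂ .n1 = c * (2 * t₂ * (4 * t₁ - t₂)) := by
  rw [zetaX24, slopeX24_eq]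
  push_cast
  ring

lemma zetaX24_n1_add_n2 (c t₁ t₂ : ℝ) : zetaX24 c t₁ t₂ .n1 + zetaX24 c t₁ t₂ .n2 = 0 := by
  simp only [zetaX24, slopeX24_eq]
  push_cast
  ring

theorem mainTheorem1 :
    (∀ (l : ℕ) (ζ : TwoNode l → ℝ), ζ .n1 + ζ .n2 = 0 →
      (ζ .n1 < 0 →
        (∃ e : TwoNode.Moduli l ζ ≃ₜ Projectivization ℂ (Fin l → ℂ),
          ∀ (U : Set (Projectivization ℂ (Fin l → ℂ)))
            (φ : Projectivization ℂ (Fin l → ℂ) → ℂ),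
            Projectivization.IsRegularOn U φ ↔
              QuiverRep.Moduli.IsRegularOn (e ⁻¹' U) (φ ∘ e)) ∧
        (∃ P : Polynomial ℤ, HasPoincarePolynomial (TwoNode.Moduli l ζ) P ∧
          P * (Polynomial.X ^ 2 - 1) = Polynomial.X ^ (2 * l) - 1) ∧
        QuiverRep.dtInvariant (TwoNode.dim l) ζ = (-1) ^ (l + 1) * (l : ℤ)) ∧
      (0 < ζ .n1 →
        IsEmpty (TwoNode.Moduli l ζ) ∧
        HasPoincarePolynomial (TwoNode.Moduli l ζ) 0 ∧
        QuiverRep.dtInvariant (TwoNode.dim l) ζ = 0)) ∧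
    (∀ c t₁ t₂ : ℝ, 0 < c → 0 < t₁ → 0 < t₂ →
      (4 < t₂ / t₁ → QuiverRep.dtInvariant (TwoNode.dim 10) (zetaX24 c t₁ t₂) = -10) ∧
      (t₂ / t₁ ≤ 4 → QuiverRep.dtInvariant (TwoNode.dim 10) (zetaX24 c t₁ t₂) = 0)) := by
  refine ⟨fun l ζ h => ⟨fun h₁ => ⟨⟨TwoNode.moduliHomeomorph h h₁, TwoNode.isRegularOn_iff h h₁⟩,
    TwoNode.exists_hasPoincarePolynomial h h₁, TwoNode.dtInvariant_of_neg h h₁⟩, fun h₁ => ?_⟩,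
    fun c t₁ t₂ hc ht₁ ht₂ => ⟨fun ht => ?_, fun ht => ?_⟩⟩
  · have := TwoNode.isEmpty_moduli h h₁.le
    exact ⟨this, HasBetti.hasPoincarePolynomial hasBetti_of_isEmpty fun i => by simp,
      TwoNode.dtInvariant_of_nonneg h h₁.le⟩
  · rw [lt_div_iff₀ ht₁] at ht
    rw [TwoNode.dtInvariant_of_neg (zetaX24_n1_add_n2 c t₁ t₂)]
    · norm_num
    · rw [zetaX24_n1]
      exact mul_neg_of_pos_of_neg hc (mul_neg_of_pos_of_neg (by positivity) (by linarith))
  · rw [div_le_iff₀ ht₁] at ht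
    refine TwoNode.dtInvariant_of_nonneg (zetaX24_n1_add_n2 c t₁ t₂) ?_
    rw [zetaX24_n1]
    exact mul_nonneg hc.le (mul_nonneg (by positivity) (by linarith))
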